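/- Let $X_3$ be the doubled equilateral triangle: the metric space obtained from two copies (faces) of a solid equilateral triangle (of any side length) by gluing them along their common edges. Two points on the same face have their Euclidean distance, and two points $x,y$ on opposite faces have distance $\min_z\,(|x-z|+|z-y|)$, the minimum being over all edge points $z$. For an integer $k\ge 1$, a $1/k$-geodesic in a metric space $M$ is a nonconstant closed curve $\gamma\colon S^1\to M$ of constant speed that is locally length-minimizing and that, if $L$ denotes its length, minimizes length between its end points on every subinterval of length $L/k$. The minimizing index of $M$ is the smallest integer $k\ge 1$ such that $M$ admits a $1/k$-geodesic. Then the minimizing index of $X_3$ is $6$: the space $X_3$ admits a $1/6$-geodesic, and it admits no $1/k$-geodesic for any $1\le k\le 5$. (Thus the conjecture that the doubled regular $p$-gon has minimizing index $2p$ for every odd prime $p$ holds for $p=3$.) -/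

import Mathlib

open scoped NNReal ENNReal

noncomputable section

/-! ### Closed geodesics and `1/k`-geodesics in a metric space -/

/-- The curve `γ` minimizes on the parameter interval `[a, b]`: the length of its restriction to
`[a, b]` (the total variation) equals the distance between the two end points. -/
def MinimizesOn {M : Type*} [MetricSpace M] (γ : ℝ → M) (a b : ℝ) : Prop :=
  eVariationOn γ (Set.Icc a b) = edist (γ a) (γ b)

/-- The circle `S¹ = ℝ / 2πℤ`. -/
abbrev ParamCircle : Type := AddCircle (2 * Real.pi)

/-- The `2π`-periodic curve on `ℝ` given by a map on the circle. -/
def periodicLift {M : Type*} (γ : ParamCircle → M) : ℝ → M := fun t => γ (t : ParamCircle)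

/-- The length of a closed curve, `∞` if it is not rectifiable. -/
def closedLength {M : Type*} [MetricSpace M] (γ : ParamCircle → M) : ℝ≥0∞ :=
  eVariationOn (periodicLift γ) (Set.Icc 0 (2 * Real.pi))

/-- A (nonconstant) constant speed closed geodesic: a map from the circle that has constant
positive speed and minimizes on a neighbourhood of every parameter. -/
structure IsClosedGeodesic {M : Type*} [MetricSpace M] (γ : ParamCircle → M) : Prop where
  constant_speed : ∃ c : ℝ≥0, 0 < c ∧ HasConstantSpeedOnWith (periodicLift γ) Set.univ c
  locally_minimizing : ∀ t : ℝ, ∃ ε : ℝ, 0 < ε ∧ MinimizesOn (periodicLift γ) (t - ε) (t + ε)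

/-- A `1/k`-geodesic, `k ≥ 1`: a constant speed closed geodesic, of length `L` say, that minimizes
on all its subintervals of length `L / k`. -/
structure IsOneOverGeodesic {M : Type*} [MetricSpace M] (k : ℕ) (γ : ParamCircle → M) :
    Prop where
  pos : 0 < k
  closed_geodesic : IsClosedGeodesic γ
  minimizes : ∀ a b : ℝ, a ≤ b →
    eVariationOn (periodicLift γ) (Set.Icc a b) = closedLength γ / (k : ℝ≥0∞) →
    MinimizesOn (periodicLift γ) a b

/-- The set of all `k` for which `M` admits a `1/k`-geodesic. -/
def geodesicIndices (M : Type*) [MetricSpace M] : Set ℕ :=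
  {k | ∃ γ : ParamCircle → M, IsOneOverGeodesic k γ}

/-- The minimizing index: the smallest `k` such that `M` admits a `1/k`-geodesic
(and `0`, by convention, if there is no such `k`). -/
def minimizingIndex (M : Type*) [MetricSpace M] : ℕ := sInf (geodesicIndices M)

/-! ### Doubled regular polygons -/

/-- The `k`-th vertex of the regular `n`-gon with circumradius `r` centred at the origin. -/
def polygonVertex (n : ℕ) (r : ℝ) (k : ℕ) : ℂ :=
  (r : ℂ) * Complex.exp (2 * Real.pi * Complex.I * k / n)

/-- The solid regular `n`-gon with circumradius `r`, one face of the doubled polygon. -/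
def polygonFace (n : ℕ) (r : ℝ) : Set ℂ :=
  convexHull ℝ (Set.range (polygonVertex n r))

/-- The edge points (vertices included) of the regular `n`-gon with circumradius `r`. -/
def polygonEdges (n : ℕ) (r : ℝ) : Set ℂ :=
  ⋃ k : ℕ, segment ℝ (polygonVertex n r k) (polygonVertex n r (k + 1))

theorem polygonEdges_subset_polygonFace (n : ℕ) (r : ℝ) :
    polygonEdges n r ⊆ polygonFace n r :=
  Set.iUnion_subset fun k =>
    segment_subset_convexHull (Set.mem_range_self k) (Set.mem_range_self (k + 1))

instance polygonEdges_nonempty (n : ℕ) (r : ℝ) : Nonempty (polygonEdges n r) :=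
  ⟨⟨polygonVertex n r 0, Set.mem_iUnion.2 ⟨0, left_mem_segment ℝ _ _⟩⟩⟩

/-- The inclusion of the edge points into a face. -/
def edgeInclusion (n : ℕ) (r : ℝ) : polygonEdges n r → polygonFace n r :=
  Set.inclusion (polygonEdges_subset_polygonFace n r)

theorem edgeInclusion_isometry (n : ℕ) (r : ℝ) : Isometry (edgeInclusion n r) :=
  fun _ _ => rfl

/-- The doubled regular `n`-gon `X_n` with circumradius `r`: two copies of the solid polygon, each
with the Euclidean distance, glued along their common edge points. -/
abbrev DoubledPolygon (n : ℕ) (r : ℝ) : Type :=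
  Metric.GlueSpace (edgeInclusion_isometry n r) (edgeInclusion_isometry n r)

/-- The inclusion of the top face. -/
def topFace (n : ℕ) (r : ℝ) : polygonFace n r → DoubledPolygon n r :=
  Metric.toGlueL (edgeInclusion_isometry n r) (edgeInclusion_isometry n r)

/-- The inclusion of the bottom face. -/
def bottomFace (n : ℕ) (r : ℝ) : polygonFace n r → DoubledPolygon n r :=
  Metric.toGlueR (edgeInclusion_isometry n r) (edgeInclusion_isometry n r)

/-- On the top face, the distance is Euclidean. -/
theorem dist_topFace (n : ℕ) (r : ℝ) (x y : polygonFace n r) :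
    dist (topFace n r x) (topFace n r y) = dist (x : ℂ) (y : ℂ) :=
  (Metric.toGlueL_isometry _ _).dist_eq x y

/-- On the bottom face, the distance is Euclidean. -/
theorem dist_bottomFace (n : ℕ) (r : ℝ) (x y : polygonFace n r) :
    dist (bottomFace n r x) (bottomFace n r y) = dist (x : ℂ) (y : ℂ) :=
  (Metric.toGlueR_isometry _ _).dist_eq x y

/-- Between the faces, it is the least length of a broken line through an edge point. -/
theorem dist_topFace_bottomFace (n : ℕ) (r : ℝ) (x y : polygonFace n r) :
    dist (topFace n r x) (bottomFace n r y) =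
      ⨅ z : polygonEdges n r, (dist (x : ℂ) (z : ℂ) + dist (z : ℂ) (y : ℂ)) := by
  have h : dist (topFace n r x) (bottomFace n r y) =
      (⨅ z : polygonEdges n r, (dist x (edgeInclusion n r z) + dist y (edgeInclusion n r z)))
        + 0 := rfl
  rw [h, add_zero]
  refine iInf_congr fun z => ?_
  rw [dist_comm y]
  rfl

/-- The two copies of an edge point are identified. -/
theorem topFace_edge_eq_bottomFace_edge (n : ℕ) (r : ℝ) (z : polygonEdges n r) :
    topFace n r (edgeInclusion n r z) = bottomFace n r (edgeInclusion n r z) :=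
  congrFun (Metric.toGlue_commute (edgeInclusion_isometry n r) (edgeInclusion_isometry n r)) z

end

noncomputable section

/-! ### Heights over the sides of the triangle -/

/-! Lower bound. A `1/k`-geodesic with `k ≤ 5` multiplies distances by a constant on parameter
intervals of length `l = T/5`, where `T = 2π` is its period. Folding both faces onto one plane
triangle turns it into a billiard path: it cannot stay in one face or run along an edge forever,
because it would then be an unbounded straight line (`not_dist_on_Ici`). Edge times are therefore at
least `l` apart (`edge_gap`). Vertices are avoided, since the angle there is acute in each face
(`eq_of_height_eq_zero`), and first variation gives the reflection law at each edge
(`reflection_law`).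

One period thus contains at most five bounces. The face changes at every bounce, so their number is
even: two or four. With two bounces, or with four on sides in the pattern `a m a m`, the velocity is
fixed by a nontrivial rotation and must vanish. Up to a shift, the only other cyclic pattern is `a m
a k`. Its closing conditions force perpendicular crossings of `m` and of `k`, and there a shortcut
through the side `a` shows that each of the four arcs lasts at least `3l/2` (`long_arc`). The period
would be at least `6l > 5l`, which is impossible (`not_five`).

Existence. The Fagnano orbit through the midpoints of the sides has three bounces, so it closes up
in the double after two turns, with six equal arcs. It minimizes over the length of one arc, as
reflecting an end point in each side shows (`dist_across_midpoint`, `dist_fagnanoCurve`).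

All plane geometry is done in the three heights over the sides. They have constant sum and determine
distances symmetrically, so arguments are uniform in the labelling of the sides. -/

/-- The inner unit normals of the sides of the triangle. -/
def triNormal : Fin 3 → ℂ := ![1, ⟨-1 / 2, √3 / 2⟩, ⟨-1 / 2, -(√3 / 2)⟩]

/-- The component of a vector along the `j`-th inner normal. -/
def slope3 (j : Fin 3) (w : ℂ) : ℝ := (triNormal j).re * w.re + (triNormal j).im * w.im

/-- The signed distance to the line through the `j`-th side. -/
def height (r : ℝ) (j : Fin 3) (z : ℂ) : ℝ := r / 2 + slope3 j z

/-- The point with given heights. -/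
def ofHeights (b : Fin 3 → ℝ) : ℂ := (2 / 3 : ℝ) • ∑ j, b j • triNormal j

theorem sq_sqrt_three : √3 * √3 = 3 := Real.mul_self_sqrt (by norm_num)

theorem sum_slope3 (w : ℂ) : ∑ j, slope3 j w = 0 := by
  simp [Fin.sum_univ_three, slope3, triNormal]; ring

theorem sum_height (r : ℝ) (z : ℂ) : ∑ j, height r j z = 3 * r / 2 := by
  simp only [height, Finset.sum_add_distrib, sum_slope3]; simp; ring

/-- The three unit normals form a tight frame of the plane. This makes squared distances symmetric
quadratic polynomials in the heights. -/
theorem norm_sq_eq_slope3 (w : ℂ) : ‖w‖ ^ 2 = 2 / 3 * ∑ j, slope3 j w ^ 2 := by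
  rw [Complex.sq_norm, Complex.normSq_apply]
  simp [Fin.sum_univ_three, slope3, triNormal]
  linear_combination (-1 / 3) * w.im ^ 2 * sq_sqrt_three

theorem slope3_sub (j : Fin 3) (x y : ℂ) : slope3 j (x - y) = slope3 j x - slope3 j y := by
  simp [slope3]; ring

theorem slope3_smul (j : Fin 3) (t : ℝ) (w : ℂ) : slope3 j (t • w) = t * slope3 j w := by
  simp [slope3]; ring

theorem height_add_smul (r : ℝ) (j : Fin 3) (z : ℂ) (t : ℝ) (w : ℂ) :
    height r j (z + t • w) = height r j z + t * slope3 j w := by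
  simp [height, slope3]; ring

theorem dist_sq_eq_height (r : ℝ) (x y : ℂ) :
    dist x y ^ 2 = 2 / 3 * ∑ j, (height r j x - height r j y) ^ 2 := by
  rw [dist_eq_norm, norm_sq_eq_slope3]
  simp [slope3_sub, height]

theorem continuous_height (r : ℝ) (j : Fin 3) : Continuous (height r j) := by
  unfold height slope3; fun_prop

theorem height_ofHeights (r : ℝ) (b : Fin 3 → ℝ) (hb : ∑ j, b j = 3 * r / 2) (j : Fin 3) :
    height r j (ofHeights b) = b j := by
  rw [Fin.sum_univ_three] at hb
  fin_cases j <;> simp [height, slope3, ofHeights, triNormal, Fin.sum_univ_three]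
  · linear_combination (-1 / 3) * hb
  · linear_combination (-1 / 3) * hb + (b 1 - b 2) / 6 * sq_sqrt_three
  · linear_combination (-1 / 3) * hb + (b 2 - b 1) / 6 * sq_sqrt_three

theorem eq_of_height_eq {r : ℝ} {x y : ℂ} (h : ∀ j, height r j x = height r j y) : x = y := by
  have := dist_sq_eq_height r x y
  simp only [h, sub_self] at this
  simpa using this

theorem abs_height_sub_le (r : ℝ) (j : Fin 3) (x y : ℂ) :
    |height r j x - height r j y| ≤ dist x y := by
  apply abs_le_of_sq_le_sq _ dist_nonneg
  have h1 := dist_sq_eq_height r x y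
  have h2 := sum_height r x
  have h3 := sum_height r y
  rw [Fin.sum_univ_three] at h1 h2 h3
  rw [h1]
  obtain ⟨a, ha⟩ : ∃ a, a = height r 0 x - height r 0 y := ⟨_, rfl⟩
  obtain ⟨b, hb⟩ : ∃ b, b = height r 1 x - height r 1 y := ⟨_, rfl⟩
  have hc : height r 2 x - height r 2 y = -(a + b) := by linarith
  fin_cases j <;> simp only [Fin.zero_eta, Fin.mk_one, Fin.reduceFinMk] <;>
    rw [hc, ← ha, ← hb] <;> nlinarith [sq_nonneg (a - b), sq_nonneg (a + 2 * b),
      sq_nonneg (b + 2 * a)]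

theorem sum_fin_three {a b c : Fin 3} (hab : a ≠ b) (hac : a ≠ c) (hbc : b ≠ c)
    (F : Fin 3 → ℝ) : ∑ j, F j = F a + F b + F c := by
  have : (Finset.univ : Finset (Fin 3)) = {a, b, c} := by
    revert a b c; decide
  rw [this, Finset.sum_insert (by simp [hab, hac]), Finset.sum_pair hbc]; ring

theorem forall_fin_three {a b c : Fin 3} (hab : a ≠ b) (hac : a ≠ c) (hbc : b ≠ c)
    {F : Fin 3 → Prop} (ha : F a) (hb : F b) (hc : F c) (j : Fin 3) : F j := by
  have : j = a ∨ j = b ∨ j = c := by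
    clear ha hb hc F; revert a b c j; decide
  rcases this with rfl | rfl | rfl <;> assumption

/-! ### The face and its edges in terms of heights -/

theorem polygonVertex_three_mul (r : ℝ) (k : ℕ) :
    polygonVertex 3 r k = (r : ℂ) * Complex.exp (2 * Real.pi * Complex.I / 3) ^ k := by
  rw [polygonVertex, ← Complex.exp_nat_mul]
  congr 2
  push_cast
  ring

theorem exp_two_pi_I_div_three : Complex.exp (2 * Real.pi * Complex.I / 3) = triNormal 1 := by
  have h : 2 * (Real.pi : ℂ) * Complex.I / 3 = ((Real.pi - Real.pi / 3 : ℝ) : ℂ) * Complex.I := by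
    push_cast; ring
  rw [h, Complex.exp_mul_I, ← Complex.ofReal_cos, ← Complex.ofReal_sin, Real.cos_pi_sub,
    Real.sin_pi_sub, Real.cos_pi_div_three, Real.sin_pi_div_three]
  apply Complex.ext <;> simp [triNormal]
  ring

theorem triNormal_pow (k : ℕ) : triNormal 1 ^ k = triNormal (Fin.ofNat 3 k) := by
  have h3 : triNormal 1 ^ 3 = 1 := by
    rw [← exp_two_pi_I_div_three, ← Complex.exp_nat_mul]
    convert Complex.exp_two_pi_mul_I using 2
    push_cast; ring
  have h2 : triNormal 1 ^ 2 = triNormal 2 := by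
    apply Complex.ext <;> simp [triNormal, sq]
    · linear_combination (-1 / 4) * sq_sqrt_three
    · ring
  rw [← Nat.div_add_mod k 3, pow_add, pow_mul, h3, one_pow, one_mul]
  have : k % 3 < 3 := Nat.mod_lt _ (by norm_num)
  have e : Fin.ofNat 3 (3 * (k / 3) + k % 3) = Fin.ofNat 3 (k % 3) := by
    ext; simp [Fin.ofNat]
  rw [e]
  interval_cases k % 3
  · simp [triNormal]
  · simp [Fin.ofNat]
  · simpa [Fin.ofNat] using h2

theorem polygonVertex_three (r : ℝ) (k : ℕ) :
    polygonVertex 3 r k = r • triNormal (Fin.ofNat 3 k) := by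
  rw [polygonVertex_three_mul, exp_two_pi_I_div_three, triNormal_pow, Complex.real_smul]

theorem height_smul_triNormal (r : ℝ) (j k : Fin 3) :
    height r j (r • triNormal k) = if j = k then 3 * r / 2 else 0 := by
  fin_cases j <;> fin_cases k <;> simp [height, slope3, triNormal] <;>
    first
      | ring1
      | linear_combination (r / 4) * sq_sqrt_three
      | linear_combination (-r / 4) * sq_sqrt_three

theorem height_convexComb (r : ℝ) (j : Fin 3) (x y : ℂ) {a b : ℝ} (hab : a + b = 1) :
    height r j (a • x + b • y) = a * height r j x + b * height r j y := by
  simp [height, slope3]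
  linear_combination (-r / 2) * hab

/-- Heights divided by the altitude `3r/2` are the barycentric coordinates, because the normal `j`
points from the centre to the vertex opposite the side `j`. -/
theorem eq_sum_height {r : ℝ} (hr : 0 < r) (z : ℂ) :
    z = ∑ j, (height r j z / (3 * r / 2)) • (r • triNormal j) := by
  have h : ofHeights (fun j => height r j z) = z :=
    eq_of_height_eq (r := r) (height_ofHeights r _ (sum_height r z))
  nth_rw 1 [← h]
  rw [ofHeights, Finset.smul_sum]
  refine Finset.sum_congr rfl fun j _ => ?_
  rw [smul_smul, smul_smul]
  congr 1
  field_simp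

theorem mem_polygonFace_three {r : ℝ} (hr : 0 < r) (z : ℂ) :
    z ∈ polygonFace 3 r ↔ ∀ j, 0 ≤ height r j z := by
  constructor
  · intro hz j
    have hconv : Convex ℝ {z | 0 ≤ height r j z} := by
      intro x hx y hy a b ha hb hab
      simp only [Set.mem_ofPred_eq] at *
      rw [height_convexComb r j x y hab]
      positivity
    refine convexHull_min ?_ hconv hz
    rintro _ ⟨k, rfl⟩
    simp only [Set.mem_ofPred_eq, polygonVertex_three, height_smul_triNormal]
    split_ifs <;> positivity
  · intro hz
    rw [eq_sum_height hr z]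
    refine (convex_convexHull ℝ _).sum_mem (fun j _ => div_nonneg (hz j) (by positivity)) ?_ ?_
    · rw [← Finset.sum_div, sum_height, div_self (by positivity)]
    · intro j _
      refine subset_convexHull ℝ _ ⟨j.val, ?_⟩
      rw [polygonVertex_three]
      simp

theorem mem_polygonEdges_three {r : ℝ} (hr : 0 < r) (z : ℂ) :
    z ∈ polygonEdges 3 r ↔ (∀ j, 0 ≤ height r j z) ∧ ∃ j, height r j z = 0 := by
  constructor
  · intro hz
    refine ⟨(mem_polygonFace_three hr z).1 (polygonEdges_subset_polygonFace 3 r hz), ?_⟩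
    obtain ⟨k, a, b, ha, hb, hab, rfl⟩ := Set.mem_iUnion.1 hz
    -- The segment from vertex `k` to vertex `k + 1` lies opposite vertex `k + 2`.
    refine ⟨Fin.ofNat 3 (k + 2), ?_⟩
    rw [height_convexComb r _ _ _ hab, polygonVertex_three, polygonVertex_three,
      height_smul_triNormal, height_smul_triNormal, if_neg, if_neg]
    · ring
    · simp only [Fin.ofNat, Fin.mk.injEq]; omega
    · simp only [Fin.ofNat, Fin.mk.injEq]; omega
  · rintro ⟨hz, j, hj⟩
    refine Set.mem_iUnion.2 ⟨j.val + 1, height r (j + 1) z / (3 * r / 2),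
      height r (j + 2) z / (3 * r / 2), div_nonneg (hz _) (by positivity),
      div_nonneg (hz _) (by positivity), ?_, ?_⟩
    · have := sum_height r z
      rw [sum_fin_three (a := j) (b := j + 1) (c := j + 2) (by clear * -; decide +revert)
        (by clear * -; decide +revert) (by clear * -; decide +revert), hj] at this
      rw [← add_div, div_eq_one_iff_eq (by positivity)]
      linarith
    · have := eq_sum_height hr z
      rw [Fin.sum_univ_three] at this
      have e1 : Fin.ofNat 3 (j.val + 1) = j + 1 := by clear * -; decide +revert
      have e2 : Fin.ofNat 3 (j.val + 1 + 1) = j + 2 := by clear * -; decide +revert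
      rw [polygonVertex_three, polygonVertex_three, e1, e2]
      nth_rw 3 [this]
      fin_cases j <;> simp at hj ⊢ <;> simp [hj]
      rw [add_comm]

/-! ### Curves in the plane that locally preserve distances -/

/-- Equality in the triangle inequality puts the three points on a segment, by strict convexity of
the plane. The third point is then found by extrapolation. -/
theorem eq_of_dist_consecutive {c s u t : ℝ} (hc : 0 < c) (hsu : s < u) (hut : u < t) {x y z : ℂ}
    (hxy : dist x y = c * (u - s)) (hyz : dist y z = c * (t - u)) (hxz : dist x z = c * (t - s)) :
    z = y + (t - u) • ((u - s)⁻¹ • (y - x)) := by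
  have hw : Wbtw ℝ x y z := by
    rw [← dist_add_dist_eq_iff, hxy, hyz, hxz]; ring
  obtain ⟨θ, -, rfl⟩ := hw
  rw [dist_left_lineMap, hxz, Real.norm_eq_abs] at hxy
  rw [dist_lineMap_right, hxz, Real.norm_eq_abs] at hyz
  have h1 : |θ| * (t - s) = u - s := by
    apply mul_left_cancel₀ hc.ne'; linarith
  have h2 : |1 - θ| * (t - s) = t - u := by
    apply mul_left_cancel₀ hc.ne'; linarith
  have hts : 0 < t - s := by linarith
  have h3 : θ * (t - s) = u - s := by
    rcases abs_cases θ with ⟨e, _⟩ | ⟨e, h⟩ <;> rw [e] at h1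
    · exact h1
    · rw [abs_of_pos (by linarith)] at h2
      nlinarith
  have h4 : (θ : ℂ) * (t - s) = u - s := by exact_mod_cast h3
  have hus : (u : ℂ) - s ≠ 0 := by
    rw [← Complex.ofReal_sub]; exact_mod_cast (sub_pos.2 hsu).ne'
  simp only [AffineMap.lineMap_apply, vsub_eq_sub, vadd_eq_add, Complex.real_smul]
  push_cast
  field_simp
  linear_combination (x - z) * h4

/-- A plane curve on `[a, b]` that multiplies all small distances by `c` is affine. -/
theorem exists_affine_of_dist {p : ℝ → ℂ} {c l a b : ℝ} (hc : 0 < c) (hl : 0 < l) (hab : a < b)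
    (h : ∀ s ∈ Set.Icc a b, ∀ t ∈ Set.Icc a b, s ≤ t → t - s ≤ l →
      dist (p s) (p t) = c * (t - s)) :
    ∃ w : ℂ, ‖w‖ = c ∧ ∀ t ∈ Set.Icc a b, p t = p a + (t - a) • w := by
  -- Since `2 * d ≤ l`, the points `a + n d`, `a + (n + 1) d` and any `t` in the next step lie
  -- within one interval of length `l`. The affine formula thus propagates step by step.
  obtain ⟨d, hd0, hdl, hdb⟩ : ∃ d, 0 < d ∧ 2 * d ≤ l ∧ 2 * d ≤ b - a :=
    ⟨min (l / 2) ((b - a) / 2), lt_min (by linarith) (by linarith),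
      by linarith [min_le_left (l / 2) ((b - a) / 2)],
      by linarith [min_le_right (l / 2) ((b - a) / 2)]⟩
  set w : ℂ := d⁻¹ • (p (a + d) - p a) with hw
  have hpd : p (a + d) = p a + d • w := by
    rw [hw, smul_smul, mul_inv_cancel₀ hd0.ne']; simp
  have hnw : ‖w‖ = c := by
    rw [hw, norm_smul, ← dist_eq_norm, dist_comm, h a ⟨le_rfl, hab.le⟩ (a + d)
      ⟨by linarith, by linarith⟩ (by linarith) (by linarith), Real.norm_eq_abs,
      abs_of_pos (by positivity)]
    field_simp; ring
  -- extrapolation from two points where the formula is known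
  have key : ∀ s ∈ Set.Icc a b, ∀ u ∈ Set.Icc a b, ∀ t ∈ Set.Icc a b, s < u → u < t → t - s ≤ l →
      p s = p a + (s - a) • w → p u = p a + (u - a) • w → p t = p a + (t - a) • w := by
    intro s hs u hu t ht hsu hut hts es eu
    rw [eq_of_dist_consecutive hc hsu hut (h s hs u hu hsu.le (by linarith))
      (h u hu t ht hut.le (by linarith)) (h s hs t ht (hsu.trans hut).le hts), es, eu]
    have : (u : ℂ) - s ≠ 0 := by
      rw [← Complex.ofReal_sub]; exact_mod_cast (sub_pos.2 hsu).ne'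
    simp only [Complex.real_smul]
    push_cast
    field_simp
    ring
  have low : ∀ t ∈ Set.Icc a (a + d), p t = p a + (t - a) • w := by
    intro t ⟨h1, h2⟩
    rcases h1.eq_or_lt with rfl | h1
    · simp
    rcases h2.eq_or_lt with rfl | h2
    · rw [hpd]; simp
    have e := eq_of_dist_consecutive hc h1 h2
      (h a ⟨le_rfl, hab.le⟩ t ⟨h1.le, by linarith⟩ h1.le (by linarith))
      (h t ⟨h1.le, by linarith⟩ (a + d) ⟨by linarith, by linarith⟩ h2.le (by linarith))
      (h a ⟨le_rfl, hab.le⟩ (a + d) ⟨by linarith, by linarith⟩ (by linarith) (by linarith))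
    have : (t : ℂ) - a ≠ 0 := by
      rw [← Complex.ofReal_sub]; exact_mod_cast (sub_pos.2 h1).ne'
    have hd : (d : ℂ) ≠ 0 := by exact_mod_cast hd0.ne'
    rw [hpd] at e
    simp only [Complex.real_smul] at e ⊢
    push_cast at e ⊢
    field_simp at e
    apply mul_left_cancel₀ hd
    linear_combination -e
  have all : ∀ n : ℕ, ∀ t ∈ Set.Icc a b, t ≤ a + (n + 1) * d → p t = p a + (t - a) • w := by
    intro n
    induction n with
    | zero => exact fun t ht h2 => low t ⟨ht.1, by simpa using h2⟩
    | succ n ih =>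
      intro t ht h2
      push_cast at h2
      rcases le_or_gt t (a + (n + 1) * d) with h3 | h3
      · exact ih t ht h3
      have hn : 0 ≤ (n : ℝ) * d := by positivity
      have m1 : a + n * d ∈ Set.Icc a b := ⟨by linarith, by linarith [ht.2]⟩
      have m2 : a + (n + 1) * d ∈ Set.Icc a b := ⟨by linarith, by linarith [ht.2]⟩
      exact key _ m1 _ m2 t ht (by linarith) h3 (by linarith) (ih _ m1 (by linarith))
        (ih _ m2 le_rfl)
  refine ⟨w, hnw, fun t ht => ?_⟩
  obtain ⟨n, hn⟩ := exists_nat_gt ((t - a) / d)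
  rw [div_lt_iff₀ hd0] at hn
  exact all n t ht (by linarith)

/-- A bounded curve cannot multiply all small distances on a half-line. -/
theorem not_dist_on_Ici {p : ℝ → ℂ} {c l a B : ℝ} (hc : 0 < c) (hl : 0 < l)
    (hB : ∀ s t, dist (p s) (p t) ≤ B)
    (h : ∀ s t, a ≤ s → s ≤ t → t - s ≤ l → dist (p s) (p t) = c * (t - s)) : False := by
  have hB0 : 0 ≤ B := dist_nonneg.trans (hB 0 0)
  obtain ⟨w, hw, hp⟩ := exists_affine_of_dist (b := a + (B + 1) / c) hc hl
    (by have : 0 < (B + 1) / c := by positivity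
        linarith) (fun s hs t _ hst hts => h s t hs.1 hst hts)
  have hpos : 0 < (B + 1) / c := by positivity
  have h1 := hB (a + (B + 1) / c) a
  rw [hp _ ⟨by linarith, le_rfl⟩, dist_eq_norm] at h1
  simp only [add_sub_cancel_left, norm_smul, hw, Real.norm_eq_abs, abs_of_pos hpos] at h1
  rw [div_mul_cancel₀ _ hc.ne'] at h1
  linarith

/-! ### Periodic curves in the doubled triangle, seen from the projection to one face -/

/-- `p` is the projection to the plane of a `T`-periodic curve in the doubled triangle that
multiplies distances by `c` on all parameter intervals of length at most `l`; it is on the face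
`i` at the parameters in `side i`. -/
structure FoldedCurve (r c l T : ℝ) (p : ℝ → ℂ) (side : Bool → Set ℝ) : Prop where
  r_pos : 0 < r
  c_pos : 0 < c
  l_pos : 0 < l
  l_le : l ≤ T
  face : ∀ t j, 0 ≤ height r j (p t)
  cover : ∀ t, ∃ i, t ∈ side i
  closed : ∀ i, IsClosed (side i)
  edge_iff : ∀ t, (∀ i, t ∈ side i) ↔ ∃ j, height r j (p t) = 0
  dist_same : ∀ i, ∀ s ∈ side i, ∀ t ∈ side i, s ≤ t → t - s ≤ l → dist (p s) (p t) = c * (t - s)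
  le_edge : ∀ s t, s ≤ t → t - s ≤ l → ∀ z, (∀ j, 0 ≤ height r j z) → (∃ j, height r j z = 0) →
    c * (t - s) ≤ dist (p s) z + dist z (p t)
  periodic : ∀ t, p (t + T) = p t
  side_periodic : ∀ i t, t + T ∈ side i ↔ t ∈ side i

namespace FoldedCurve

variable {r c l T : ℝ} {p : ℝ → ℂ} {side : Bool → Set ℝ}

/-- The parameters at which the curve is at an edge point. -/
def edgeTimes (r : ℝ) (p : ℝ → ℂ) : Set ℝ := {t | ∃ j, height r j (p t) = 0}

theorem isClosed_edgeTimes (h : FoldedCurve r c l T p side) : IsClosed (edgeTimes r p) := by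
  have : edgeTimes r p = ⋂ i, side i := by
    ext t; rw [Set.mem_iInter]; exact (h.edge_iff t).symm
  rw [this]
  exact isClosed_iInter h.closed

theorem dist_edge_left (h : FoldedCurve r c l T p side) {s t : ℝ} (hs : s ∈ edgeTimes r p)
    (hst : s ≤ t) (htl : t - s ≤ l) : dist (p s) (p t) = c * (t - s) := by
  obtain ⟨i, hi⟩ := h.cover t
  exact h.dist_same i s ((h.edge_iff s).2 hs i) t hi hst htl

theorem dist_edge_right (h : FoldedCurve r c l T p side) {s t : ℝ} (ht : t ∈ edgeTimes r p)
    (hst : s ≤ t) (htl : t - s ≤ l) : dist (p s) (p t) = c * (t - s) := by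
  obtain ⟨i, hi⟩ := h.cover s
  exact h.dist_same i s hi t ((h.edge_iff t).2 ht i) hst htl

theorem dist_le (h : FoldedCurve r c l T p side) (s t : ℝ) : dist (p s) (p t) ≤ 3 * r := by
  have hr := h.r_pos
  refine (pow_le_pow_iff_left₀ dist_nonneg (by positivity) two_ne_zero).1 ?_
  have hle : ∀ u j, height r j (p u) ≤ 3 * r / 2 := by
    intro u j
    rw [← sum_height r (p u)]
    exact Finset.single_le_sum (fun k _ => h.face u k) (Finset.mem_univ j)
  have hd : ∀ j, (height r j (p s) - height r j (p t)) ^ 2 ≤ (3 * r / 2) ^ 2 := by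
    intro j
    apply sq_le_sq'
    · linarith [h.face s j, hle t j]
    · linarith [h.face t j, hle s j]
  rw [dist_sq_eq_height r, Fin.sum_univ_three]
  nlinarith [hd 0, hd 1, hd 2]

theorem height_consecutive (h : FoldedCurve r c l T p side) {s u t : ℝ} (hsu : s < u) (hut : u < t)
    (h1 : dist (p s) (p u) = c * (u - s)) (h2 : dist (p u) (p t) = c * (t - u))
    (h3 : dist (p s) (p t) = c * (t - s)) (j : Fin 3) :
    (u - s) * (height r j (p t) - height r j (p u)) =
      (t - u) * (height r j (p u) - height r j (p s)) := by
  rw [eq_of_dist_consecutive h.c_pos hsu hut h1 h2 h3, height_add_smul, slope3_smul, slope3_sub]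
  have : u - s ≠ 0 := by linarith
  field_simp
  simp only [height]
  ring

/-- From an edge time the projection is straight for a time `l`. A height that is nonnegative at
both ends and zero in between vanishes on the whole segment. -/
theorem edge_window (h : FoldedCurve r c l T p side) {e u v : ℝ} (he : e ∈ edgeTimes r p)
    (hu : u ∈ edgeTimes r p) (heu : e < u) (hul : u < e + l) (hev : e ≤ v) (hvl : v ≤ e + l) :
    v ∈ edgeTimes r p := by
  have hl := h.l_pos
  obtain ⟨j, hj⟩ := hu
  have hc := h.height_consecutive heu hul (h.dist_edge_left he heu.le (by linarith))
    (h.dist_edge_left ⟨j, hj⟩ hul.le (by linarith)) (h.dist_edge_left he (by linarith)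
    (by linarith)) j
  rw [hj] at hc
  have f1 := h.face e j
  have f2 := h.face (e + l) j
  have g1 : height r j (p e) = 0 := by nlinarith
  have g2 : height r j (p (e + l)) = 0 := by
    rw [g1] at hc
    have : 0 < u - e := by linarith
    nlinarith
  rcases hev.eq_or_lt with rfl | hev
  · exact he
  rcases hvl.eq_or_lt with rfl | hvl
  · exact ⟨j, g2⟩
  refine ⟨j, ?_⟩
  have hc := h.height_consecutive hev hvl (h.dist_edge_left he hev.le (by linarith))
    (h.dist_edge_right ⟨j, g2⟩ hvl.le (by linarith)) (h.dist_edge_left he (by linarith)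
    (by linarith)) j
  rw [g1, g2] at hc
  have : l * height r j (p v) = 0 := by linarith
  exact (mul_eq_zero.1 this).resolve_left hl.ne'

/-- Two closer edge times would trap the curve in the edges forever. All small distances would then
be multiplied by `c`, against boundedness. -/
theorem edge_gap (h : FoldedCurve r c l T p side) {e u : ℝ} (he : e ∈ edgeTimes r p)
    (hu : u ∈ edgeTimes r p) (heu : e < u) : e + l ≤ u := by
  by_contra! hul
  have hl := h.l_pos
  have all : ∀ n : ℕ, ∀ v, e ≤ v → v ≤ e + l + n * (l / 2) → v ∈ edgeTimes r p := by
    intro n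
    induction n with
    | zero => exact fun v h1 h2 => h.edge_window he hu heu hul h1 (by simpa using h2)
    | succ n ih =>
      intro v h1 h2
      push_cast at h2
      have hn : 0 ≤ (n : ℝ) * (l / 2) := by positivity
      rcases le_or_gt v (e + l + n * (l / 2)) with h3 | h3
      · exact ih v h1 h3
      -- These two edge times are `l / 2` apart, so the window they open reaches `l / 2` beyond the
      -- known range.
      exact h.edge_window (e := e + l / 2 + n * (l / 2)) (u := e + l + n * (l / 2))
        (ih _ (by linarith) (by linarith)) (ih _ (by linarith) le_rfl) (by linarith) (by linarith)
        (by linarith) (by linarith)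
  refine not_dist_on_Ici h.c_pos hl (a := e) h.dist_le fun s t hs hst htl => ?_
  refine h.dist_edge_left ?_ hst htl
  obtain ⟨n, hn⟩ := exists_nat_gt ((s - e) / (l / 2))
  rw [div_lt_iff₀ (by positivity)] at hn
  exact all n s hs (by linarith)

theorem exists_side (h : FoldedCurve r c l T p side) {a b : ℝ} (hab : a < b)
    (hE : ∀ u ∈ Set.Ioo a b, u ∉ edgeTimes r p) : ∃ i, Set.Icc a b ⊆ side i := by
  have hpre : IsPreconnected (Set.Ioo a b) := isPreconnected_Ioo
  have := (isPreconnected_iff_subset_of_disjoint_closed.1 hpre) (side true) (side false)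
    (h.closed _) (h.closed _) (fun t _ => by
      obtain ⟨i, hi⟩ := h.cover t
      cases i
      · exact Or.inr hi
      · exact Or.inl hi)
    (Set.eq_empty_of_forall_notMem fun t ht => hE t ht.1
      ((h.edge_iff t).1 (by rintro (_ | _); exacts [ht.2.2, ht.2.1])))
  rw [← closure_Ioo hab.ne]
  rcases this with h1 | h1
  · exact ⟨_, closure_minimal h1 (h.closed _)⟩
  · exact ⟨_, closure_minimal h1 (h.closed _)⟩

theorem edgeTimes_nonempty (h : FoldedCurve r c l T p side) : (edgeTimes r p).Nonempty := by
  by_contra hE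
  rw [Set.not_nonempty_iff_eq_empty] at hE
  refine not_dist_on_Ici h.c_pos h.l_pos (a := 0) h.dist_le fun s t _ hst htl => ?_
  obtain ⟨i, hi⟩ := h.exists_side (a := s) (b := t + 1) (by linarith) (by simp [hE])
  exact h.dist_same i s (hi ⟨le_rfl, by linarith⟩) t (hi ⟨hst, by linarith⟩) hst htl

theorem edgeTimes_add (h : FoldedCurve r c l T p side) (t : ℝ) :
    t + T ∈ edgeTimes r p ↔ t ∈ edgeTimes r p := by
  simp only [edgeTimes, Set.mem_ofPred_eq, h.periodic]

theorem exists_next (h : FoldedCurve r c l T p side) {e : ℝ} (he : e ∈ edgeTimes r p) :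
    ∃ e' ∈ edgeTimes r p, e < e' ∧ ∀ u ∈ Set.Ioo e e', u ∉ edgeTimes r p := by
  have hl := h.l_pos
  -- By the gap, all later edge times lie in this closed set, so its infimum is attained.
  -- Periodicity makes it nonempty.
  set S := edgeTimes r p ∩ Set.Ici (e + l) with hS
  have hcl : IsClosed S := h.isClosed_edgeTimes.inter isClosed_Ici
  have hbd : BddBelow S := ⟨e + l, fun x hx => hx.2⟩
  have hne : S.Nonempty := ⟨e + T, (h.edgeTimes_add e).2 he, by simpa using h.l_le⟩
  have hm := hcl.csInf_mem hne hbd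
  refine ⟨sInf S, hm.1, by linarith [hm.2.out], fun u hu huE => ?_⟩
  exact absurd (csInf_le hbd ⟨huE, h.edge_gap he huE hu.1⟩) (not_le.2 hu.2)

/-- The curve does not meet the vertices. -/
theorem eq_of_height_eq_zero (h : FoldedCurve r c l T p side) {e : ℝ} {j k : Fin 3}
    (hj : height r j (p e) = 0) (hk : height r k (p e) = 0) : j = k := by
  by_contra hjk
  have hl := h.l_pos
  have hr := h.r_pos
  have hc := h.c_pos
  obtain ⟨m, hjm, hkm⟩ : ∃ m, j ≠ m ∧ k ≠ m := by clear hj hk; decide +revert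
  have he : e ∈ edgeTimes r p := ⟨j, hj⟩
  have dx := h.dist_edge_right he (s := e - l / 2) (by linarith) (by linarith)
  have dy := h.dist_edge_left he (t := e + l / 2) (by linarith) (by linarith)
  rw [dist_comm] at dx
  have sum := sum_fin_three hjk hjm hkm
  have hv := sum_height r (p e)
  rw [sum, hj, hk] at hv
  -- Up to a positive factor this sum is the component of `p t - p e` along the side `j`, pointing
  -- away from the vertex. It is positive because the angle of the triangle is acute.
  have pos : ∀ t, dist (p e) (p t) = c * (l / 2) →
      0 < height r j (p t) + 2 * height r k (p t) := by
    intro t ht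
    have h1 := sum_height r (p t)
    have h2 := dist_sq_eq_height r (p e) (p t)
    have f1 := h.face t j
    have f2 := h.face t k
    rw [sum] at h1 h2
    by_contra! hle
    have z1 : height r j (p t) = 0 := by linarith
    have z2 : height r k (p t) = 0 := by linarith
    rw [ht, hj, hk, z1, z2, show height r m (p e) = height r m (p t) by linarith] at h2
    have : 0 < c * (l / 2) := by positivity
    nlinarith
  -- With `a`, `b` the heights of `p t` over `j`, `k`, replacing the vertex by `z` changes the
  -- squared distance by `(4/3) β (β - (a + 2b))`.
  have closer : ∀ t, dist (p e) (p t) = c * (l / 2) → ∀ β, 0 < β →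
      β < height r j (p t) + 2 * height r k (p t) →
      ∀ z, height r j z = 0 → height r k z = β → dist (p t) z < c * (l / 2) := by
    intro t ht β h0 hβ z zj zk
    have h1 := sum_height r (p t)
    have h2 := dist_sq_eq_height r (p e) (p t)
    have h3 := dist_sq_eq_height r (p t) z
    have h4 := sum_height r z
    rw [sum] at h1 h2 h3 h4
    rw [zj, zk] at h3 h4
    rw [hj, hk, ht] at h2
    apply lt_of_pow_lt_pow_left₀ 2 (by positivity)
    rw [h2, h3]
    rw [show height r m (p e) = 3 * r / 2 by linarith,
      show height r m (p t) = 3 * r / 2 - height r j (p t) - height r k (p t) by linarith,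
      show height r m z = 3 * r / 2 - β by linarith]
    nlinarith
  have px := pos (e - l / 2) (by rw [dx]; ring)
  have py := pos (e + l / 2) (by rw [dy]; ring)
  -- One small `β` serves both half-arcs. The bound `3 * r / 2` keeps the point between the two ends
  -- of its side.
  obtain ⟨β, h0, hx, hy, hβ⟩ : ∃ β, 0 < β ∧
      β < height r j (p (e - l / 2)) + 2 * height r k (p (e - l / 2)) ∧
      β < height r j (p (e + l / 2)) + 2 * height r k (p (e + l / 2)) ∧ β < 3 * r / 2 := by
    obtain ⟨β, h0, h1⟩ := exists_between (lt_min px (lt_min py (by positivity : 0 < 3 * r / 2)))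
    exact ⟨β, h0, h1.trans_le (min_le_left _ _),
      h1.trans_le ((min_le_right _ _).trans (min_le_left _ _)),
      h1.trans_le ((min_le_right _ _).trans (min_le_right _ _))⟩
  set b : Fin 3 → ℝ := fun i => if i = j then 0 else if i = k then β else 3 * r / 2 - β with hb
  have bj : b j = 0 := by simp [hb]
  have bk : b k = β := by simp [hb, Ne.symm hjk]
  have bm : b m = 3 * r / 2 - β := by simp [hb, Ne.symm hjm, Ne.symm hkm]
  have hz := height_ofHeights r b (by rw [sum, bj, bk, bm]; ring)
  have := h.le_edge (e - l / 2) (e + l / 2) (by linarith) (by linarith) (ofHeights b)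
    (forall_fin_three hjk hjm hkm (by rw [hz, bj]) (by rw [hz, bk]; exact h0.le)
      (by rw [hz, bm]; linarith)) ⟨j, by rw [hz, bj]⟩
  have c1 := closer (e - l / 2) (by rw [dx]; ring) β h0 hx _ (by rw [hz, bj]) (by rw [hz, bk])
  have c2 := closer (e + l / 2) (by rw [dy]; ring) β h0 hy _ (by rw [hz, bj]) (by rw [hz, bk])
  rw [dist_comm (ofHeights b)] at this
  linarith

theorem exists_arc (h : FoldedCurve r c l T p side) {e e' : ℝ} (hee : e < e')
    (hE : ∀ u ∈ Set.Ioo e e', u ∉ edgeTimes r p) :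
    ∃ (i : Bool) (w : ℂ), ‖w‖ = c ∧ ∀ t ∈ Set.Icc e e', t ∈ side i ∧ p t = p e + (t - e) • w := by
  obtain ⟨i, hi⟩ := h.exists_side hee hE
  obtain ⟨w, hw, hp⟩ := exists_affine_of_dist h.c_pos h.l_pos hee
    (fun s hs t ht hst htl => h.dist_same i s (hi hs) t (hi ht) hst htl)
  exact ⟨i, w, hw, fun t ht => ⟨hi ht, hp t ht⟩⟩

/-- If both arcs lay on one face, the curve would be straight through `e'`. A nonnegative height
vanishing at an interior point would then vanish along the whole arc. -/
theorem side_ne (h : FoldedCurve r c l T p side) {e e' e'' : ℝ} (h1 : e < e') (h2 : e' < e'')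
    (hE : ∀ u ∈ Set.Ioo e e', u ∉ edgeTimes r p) (he' : e' ∈ edgeTimes r p) {i i' : Bool}
    (hi : Set.Icc e e' ⊆ side i) (hi' : Set.Icc e' e'' ⊆ side i') : i ≠ i' := by
  rintro rfl
  have hs : Set.Icc e e'' ⊆ side i := by
    intro t ht
    rcases le_total t e' with h3 | h3
    · exact hi ⟨ht.1, h3⟩
    · exact hi' ⟨h3, ht.2⟩
  obtain ⟨w, -, hp⟩ := exists_affine_of_dist h.c_pos h.l_pos (h1.trans h2)
    (fun s hs' t ht hst htl => h.dist_same i s (hs hs') t (hs ht) hst htl)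
  obtain ⟨j, hj⟩ := he'
  have H : ∀ t ∈ Set.Icc e e'', height r j (p t) = height r j (p e) + (t - e) * slope3 j w := by
    intro t ht; rw [hp t ht, height_add_smul]
  have a1 := H e' ⟨h1.le, h2.le⟩
  have a2 := H e'' ⟨(h1.trans h2).le, le_rfl⟩
  rw [hj] at a1
  have f1 := h.face e j
  have f2 := h.face e'' j
  have hw : slope3 j w = 0 := by nlinarith
  refine hE ((e + e') / 2) ⟨by linarith, by linarith⟩ ⟨j, ?_⟩
  rw [H _ ⟨by linarith, by linarith⟩, hw]
  rw [hw] at a1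
  linarith

end FoldedCurve

/-! ### The reflection law and the bouncing sequence -/

/-- This is the first variation argument: the linear coefficient must vanish at an interior minimum.
-/
theorem eq_zero_of_quadratic_nonneg {d K M : ℝ} (hd : 0 < d) (hM : 0 < M)
    (h : ∀ x, |x| ≤ M → 0 ≤ d * x * K + 2 * x ^ 2) : K = 0 := by
  by_contra hK
  have hK' : 0 < |K| := abs_pos.2 hK
  set s := min (d / 4) (M / |K|) with hs
  have s0 : 0 < s := lt_min (by positivity) (by positivity)
  have s1 : s ≤ d / 4 := min_le_left _ _
  have s2 : s * |K| ≤ M := (le_div_iff₀ hK').1 (min_le_right _ _)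
  have h1 := h (-(s * K)) (by rw [abs_neg, abs_mul, abs_of_pos s0]; exact s2)
  have h2 : d * (-(s * K)) * K + 2 * (-(s * K)) ^ 2 = -(s * K ^ 2 * (d - 2 * s)) := by ring
  have h3 : 0 < s * K ^ 2 * (d - 2 * s) := by
    have : 0 < d - 2 * s := by linarith
    positivity
  linarith

/-- A choice of a point with prescribed heights. -/
theorem exists_heights {r : ℝ} {a b c : Fin 3} (hab : a ≠ b) (hac : a ≠ c) (hbc : b ≠ c)
    {x y z : ℝ} (hs : x + y + z = 3 * r / 2) :
    ∃ q, height r a q = x ∧ height r b q = y ∧ height r c q = z := by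
  set f : Fin 3 → ℝ := fun i => if i = a then x else if i = b then y else z with hf
  have fa : f a = x := by simp [hf]
  have fb : f b = y := by simp [hf, Ne.symm hab]
  have fc : f c = z := by simp [hf, Ne.symm hac, Ne.symm hbc]
  have hz := height_ofHeights r f (by rw [sum_fin_three hab hac hbc, fa, fb, fc, hs])
  exact ⟨ofHeights f, by rw [hz, fa], by rw [hz, fb], by rw [hz, fc]⟩

namespace FoldedCurve

variable {r c l T : ℝ} {p : ℝ → ℂ} {side : Bool → Set ℝ}

theorem reflection_law (h : FoldedCurve r c l T p side) {e e' e'' : ℝ} (h1 : e + l ≤ e')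
    (h2 : e' + l ≤ e'') {w w' : ℂ} (hw : ‖w‖ = c) (hw' : ‖w'‖ = c)
    (hp : ∀ t ∈ Set.Icc e e', p t = p e + (t - e) • w)
    (hp' : ∀ t ∈ Set.Icc e' e'', p t = p e' + (t - e') • w') {i j k : Fin 3} (hij : i ≠ j)
    (hik : i ≠ k) (hjk : j ≠ k) (hj : height r j (p e') = 0) :
    slope3 i w' = -slope3 k w ∧ slope3 j w' = -slope3 j w ∧ slope3 k w' = -slope3 i w := by
  have hl := h.l_pos
  have hc := h.c_pos
  have H1 : ∀ n, ∀ t ∈ Set.Icc e e', height r n (p t) = height r n (p e') - (e' - t) * slope3 n w := by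
    intro n t ht
    rw [hp t ht, hp e' ⟨by linarith, le_rfl⟩, height_add_smul, height_add_smul]; ring
  have H2 : ∀ n, ∀ t ∈ Set.Icc e' e'',
      height r n (p t) = height r n (p e') + (t - e') * slope3 n w' := by
    intro n t ht
    rw [hp' t ht, height_add_smul]
  have sum := sum_fin_three hij hik hjk
  have f1 := h.face e j
  have f2 := h.face e'' j
  rw [H1 j e ⟨le_rfl, by linarith⟩, hj] at f1
  rw [H2 j e'' ⟨by linarith, le_rfl⟩, hj] at f2
  have uj : slope3 j w ≤ 0 := by nlinarith
  have uj' : 0 ≤ slope3 j w' := by nlinarith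
  have s1 := sum_slope3 w
  have s2 := sum_slope3 w'
  have n1 := norm_sq_eq_slope3 w
  have n2 := norm_sq_eq_slope3 w'
  rw [sum] at s1 s2 n1 n2
  rw [hw] at n1
  rw [hw'] at n2
  have hq := sum_height r (p e')
  rw [sum, hj] at hq
  have qi : 0 < height r i (p e') := lt_of_le_of_ne (h.face _ _)
    fun h0 => hij (h.eq_of_height_eq_zero h0.symm hj)
  have qk : 0 < height r k (p e') := lt_of_le_of_ne (h.face _ _)
    fun h0 => hjk (h.eq_of_height_eq_zero hj h0.symm)
  -- The crossing point is moved by `x` along the side `j`. Minimality then makes the tangential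
  -- component of the velocity continuous.
  have tang : (slope3 i w - slope3 k w) - (slope3 i w' - slope3 k w') = 0 := by
    refine eq_zero_of_quadratic_nonneg (d := l / 2) (by positivity) (lt_min qi qk) fun x hx => ?_
    have hx1 := (abs_le.1 hx).1
    have hx2 := (abs_le.1 hx).2
    have m1 := min_le_left (height r i (p e')) (height r k (p e'))
    have m2 := min_le_right (height r i (p e')) (height r k (p e'))
    obtain ⟨z, zi, zj, zk⟩ := exists_heights (r := r) hij hik hjk (x := height r i (p e') + x)
      (y := 0) (z := height r k (p e') - x) (by linarith)
    have hle := h.le_edge (e' - l / 2) (e' + l / 2) (by linarith) (by linarith) z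
      (forall_fin_three hij hik hjk (by rw [zi]; linarith) (by rw [zj]) (by rw [zk]; linarith))
      ⟨j, zj⟩
    have d1 := dist_sq_eq_height r (p (e' - l / 2)) z
    have d2 := dist_sq_eq_height r z (p (e' + l / 2))
    have hm1 : e' - l / 2 ∈ Set.Icc e e' := ⟨by linarith, by linarith⟩
    have hm2 : e' + l / 2 ∈ Set.Icc e' e'' := ⟨by linarith, by linarith⟩
    rw [sum, H1 i _ hm1, H1 j _ hm1, H1 k _ hm1, zi, zj, zk, hj] at d1
    rw [sum, H2 i _ hm2, H2 j _ hm2, H2 k _ hm2, zi, zj, zk, hj] at d2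
    -- The bound `(u + v)² ≤ 2 (u² + v²)` removes the square roots. It is sharp at `x = 0`, where
    -- both halves have length `c l / 2`, so the linear term in `x` is not spoiled.
    have hsq : (c * l) ^ 2 ≤ 2 * (dist (p (e' - l / 2)) z ^ 2 + dist z (p (e' + l / 2)) ^ 2) := by
      have h0 : 0 ≤ c * l := by positivity
      have : c * l ≤ dist (p (e' - l / 2)) z + dist z (p (e' + l / 2)) := by linarith
      nlinarith [sq_nonneg (dist (p (e' - l / 2)) z - dist z (p (e' + l / 2)))]
    rw [d1, d2] at hsq
    linear_combination (3 / 8) * hsq - (3 / 16) * l ^ 2 * n1 - (3 / 16) * l ^ 2 * n2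
  -- Equal speeds and equal tangential components leave only the sign of the normal component, which
  -- is fixed by arriving at the side and leaving it.
  have hsq : slope3 j w' ^ 2 = slope3 j w ^ 2 := by
    linear_combination n1 - n2 - (1 / 3) * s2 * (slope3 i w' + slope3 k w' - slope3 j w') +
      (1 / 3) * s1 * (slope3 i w + slope3 k w - slope3 j w) +
      (1 / 3) * tang * ((slope3 i w - slope3 k w) + (slope3 i w' - slope3 k w'))
  have hneg : slope3 j w' = -slope3 j w := by
    rcases sq_eq_sq_iff_eq_or_eq_neg.1 hsq with h0 | h0 <;> linarith
  refine ⟨by linarith, hneg, by linarith⟩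

/-- Where the curve crosses an edge perpendicularly, coming from the side `i`, the preceding arc
is long, since otherwise there is a shortcut through the side `i`. -/
theorem long_arc (h : FoldedCurve r c l T p side) {e e' e'' : ℝ} (h1 : e + l ≤ e')
    (h2 : e' + l ≤ e'') {w w' : ℂ}
    (hp : ∀ t ∈ Set.Icc e e', p t = p e + (t - e) • w)
    (hp' : ∀ t ∈ Set.Icc e' e'', p t = p e' + (t - e') • w') {i j k : Fin 3} (hij : i ≠ j)
    (hik : i ≠ k) (hjk : j ≠ k) (hi : height r i (p e) = 0) (hj : height r j (p e') = 0)
    (wi : slope3 i w = c / 2) (wj : slope3 j w = -c) (wk : slope3 k w = c / 2)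
    (wi' : slope3 i w' = -(c / 2)) (wj' : slope3 j w' = c) (wk' : slope3 k w' = -(c / 2)) :
    3 * l / 2 ≤ e' - e := by
  have hl := h.l_pos
  have hc := h.c_pos
  have H1 : ∀ n, ∀ t ∈ Set.Icc e e', height r n (p t) = height r n (p e') - (e' - t) * slope3 n w := by
    intro n t ht
    rw [hp t ht, hp e' ⟨by linarith, le_rfl⟩, height_add_smul, height_add_smul]; ring
  have H2 : ∀ n, ∀ t ∈ Set.Icc e' e'',
      height r n (p t) = height r n (p e') + (t - e') * slope3 n w' := by
    intro n t ht
    rw [hp' t ht, height_add_smul]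
  have sum := sum_fin_three hij hik hjk
  have hq := sum_height r (p e')
  rw [sum, hj] at hq
  have qi := H1 i e ⟨le_rfl, by linarith⟩
  rw [hi, wi] at qi
  have hm1 : e' - l / 2 ∈ Set.Icc e e' := ⟨by linarith, by linarith⟩
  have hm2 : e' + l / 2 ∈ Set.Icc e' e'' := ⟨by linarith, by linarith⟩
  have xi := H1 i _ hm1
  have xj := H1 j _ hm1
  have xk := H1 k _ hm1
  have yi := H2 i _ hm2
  have yj := H2 j _ hm2
  have yk := H2 k _ hm2
  rw [wi] at xi
  rw [wj, hj] at xj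
  rw [wk] at xk
  rw [wi'] at yi
  rw [wj', hj] at yj
  rw [wk'] at yk
  set X := height r i (p (e' - l / 2)) with hX
  have hX0 : 0 ≤ X := h.face _ _
  have hk0 := h.face (e' - l / 2) k
  -- After a perpendicular crossing the points at `e' ± l / 2` have the same projection, at height
  -- `X` over the side `i`. The competitor passes through the foot `z` of the perpendicular to that
  -- side and has length `2 X = c (e' - e - l / 2)`.
  obtain ⟨z, zi, zj, zk⟩ := exists_heights (r := r) hij hik hjk (x := 0) (y := l / 2 * c + X / 2)
    (z := height r k (p (e' - l / 2)) + X / 2) (by rw [xk]; linarith)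
  have hle := h.le_edge (e' - l / 2) (e' + l / 2) (by linarith) (by linarith) z
    (forall_fin_three hij hik hjk (by rw [zi]) (by rw [zj]; positivity) (by rw [zk]; positivity))
    ⟨i, zi⟩
  have d1 := dist_sq_eq_height r (p (e' - l / 2)) z
  have d2 := dist_sq_eq_height r z (p (e' + l / 2))
  rw [sum, zi, zj, zk, ← hX, xj] at d1
  rw [sum, zi, zj, zk, show height r i (p (e' + l / 2)) = X by linarith, yj,
    show height r k (p (e' + l / 2)) = height r k (p (e' - l / 2)) by linarith] at d2
  have d1' : dist (p (e' - l / 2)) z = X := by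
    rw [← sq_eq_sq₀ dist_nonneg hX0, d1]; ring
  have d2' : dist z (p (e' + l / 2)) = X := by
    rw [← sq_eq_sq₀ dist_nonneg hX0, d2]; ring
  rw [d1', d2'] at hle
  have : 0 ≤ c * ((e' - e) - 3 * l / 2) := by linarith
  linarith [nonneg_of_mul_nonneg_right this hc]

/-- The bouncing sequence: the successive edge parameters `e`, the sides `j` met there, and the
velocities `w` and faces `f` of the following arcs. -/
structure Bounces (r c l T : ℝ) (p : ℝ → ℂ) (side : Bool → Set ℝ) (e : ℕ → ℝ) (j : ℕ → Fin 3)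
    (w : ℕ → ℂ) (f : ℕ → Bool) : Prop where
  gap : ∀ n, e n + l ≤ e (n + 1)
  height_zero : ∀ n, height r (j n) (p (e n)) = 0
  norm_eq : ∀ n, ‖w n‖ = c
  no_edge : ∀ n, ∀ t ∈ Set.Ioo (e n) (e (n + 1)), t ∉ edgeTimes r p
  subset_side : ∀ n, Set.Icc (e n) (e (n + 1)) ⊆ side (f n)
  affine : ∀ n, ∀ t ∈ Set.Icc (e n) (e (n + 1)), p t = p (e n) + (t - e n) • w n

theorem exists_bounces (h : FoldedCurve r c l T p side) :
    ∃ e j w f, Bounces r c l T p side e j w f := by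
  obtain ⟨e₀, he₀⟩ := h.edgeTimes_nonempty
  choose nxt hn using fun x : edgeTimes r p => h.exists_next x.2
  set E : ℕ → edgeTimes r p := fun n => (fun x => ⟨nxt x, (hn x).1⟩)^[n] ⟨e₀, he₀⟩ with hE
  have hsucc : ∀ n, (E (n + 1) : ℝ) = nxt (E n) := by
    intro n; simp only [hE, Function.iterate_succ_apply']
  have lt : ∀ n, (E n : ℝ) < E (n + 1) := fun n => by rw [hsucc]; exact (hn _).2.1
  have no : ∀ n, ∀ t ∈ Set.Ioo (E n : ℝ) (E (n + 1)), t ∉ edgeTimes r p := fun n => by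
    rw [hsucc]; exact (hn _).2.2
  choose f w hw ha using fun n => h.exists_arc (lt n) (no n)
  choose j hj using fun n => (E n).2
  exact ⟨fun n => E n, j, w, f, fun n => h.edge_gap (E n).2 (E (n + 1)).2 (lt n), hj, hw, no,
    fun n t ht => (ha n t ht).1, fun n t ht => (ha n t ht).2⟩

end FoldedCurve

/-! ### Exclusion of closed bouncing sequences with at most five bounces -/

/-- Eliminating `x₁` and `x₃` leaves `(α - γ)(α + γ)(x₀ α + x₂ γ) = 0`, whose last two factors are
positive. -/
theorem eq_of_balance {α γ x₀ x₁ x₂ x₃ : ℝ} (hα : 0 < α) (hγ : 0 < γ) (h₀ : 0 < x₀)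
    (h₂ : 0 < x₂) (E₁ : x₀ * α = x₁ * γ) (E₂ : x₂ * γ = x₃ * α)
    (E₃ : (α + γ) * (x₁ - x₀) = x₃ * γ - x₂ * α) : α = γ := by
  have h₁ : x₁ = x₀ * α / γ := by field_simp; linarith
  have h₃ : x₃ = x₂ * γ / α := by field_simp; linarith
  rw [h₁, h₃] at E₃
  field_simp at E₃
  have h : (α - γ) * ((α + γ) * (x₀ * α + x₂ * γ)) = 0 := by linarith
  have hp : 0 < (α + γ) * (x₀ * α + x₂ * γ) := by positivity
  linarith [(mul_eq_zero.1 h).resolve_right hp.ne']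

namespace FoldedCurve

variable {r c l T : ℝ} {p : ℝ → ℂ} {side : Bool → Set ℝ} {e : ℕ → ℝ} {j : ℕ → Fin 3}
  {w : ℕ → ℂ} {f : ℕ → Bool}

theorem Bounces.shift (b : Bounces r c l T p side e j w f) :
    Bounces r c l T p side (fun n => e (n + 1)) (fun n => j (n + 1)) (fun n => w (n + 1))
      (fun n => f (n + 1)) :=
  ⟨fun _ => b.gap _, fun _ => b.height_zero _, fun _ => b.norm_eq _, fun _ => b.no_edge _,
    fun _ => b.subset_side _, fun _ => b.affine _⟩

theorem Bounces.lt_succ (b : Bounces r c l T p side e j w f) (h : FoldedCurve r c l T p side)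
    (n : ℕ) : e n < e (n + 1) := by
  linarith [b.gap n, h.l_pos]

theorem Bounces.mem_edgeTimes (b : Bounces r c l T p side e j w f) (n : ℕ) :
    e n ∈ edgeTimes r p := ⟨j n, b.height_zero n⟩

theorem Bounces.succ_le (b : Bounces r c l T p side e j w f) {n : ℕ} {x : ℝ}
    (hx : x ∈ edgeTimes r p) (hn : e n < x) : e (n + 1) ≤ x := by
  by_contra! hlt
  exact b.no_edge n x ⟨hn, hlt⟩ hx

theorem Bounces.height_affine (b : Bounces r c l T p side e j w f) (n : ℕ) (i : Fin 3) {t : ℝ}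
    (ht : t ∈ Set.Icc (e n) (e (n + 1))) :
    height r i (p t) = height r i (p (e n)) + (t - e n) * slope3 i (w n) := by
  rw [b.affine n t ht, height_add_smul]

theorem Bounces.height_succ (b : Bounces r c l T p side e j w f) (h : FoldedCurve r c l T p side)
    (n : ℕ) (i : Fin 3) : height r i (p (e (n + 1))) =
      height r i (p (e n)) + (e (n + 1) - e n) * slope3 i (w n) :=
  b.height_affine n i ⟨(b.lt_succ h n).le, le_rfl⟩

theorem Bounces.side_succ_ne (b : Bounces r c l T p side e j w f)
    (h : FoldedCurve r c l T p side) (n : ℕ) : j n ≠ j (n + 1) := by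
  intro hj
  have lt := b.lt_succ h n
  have h1 := b.height_succ h n (j n)
  rw [b.height_zero, hj, b.height_zero (n + 1), ← hj, zero_add] at h1
  have hw : slope3 (j n) (w n) = 0 :=
    (mul_eq_zero.1 h1.symm).resolve_left (by linarith)
  refine b.no_edge n ((e n + e (n + 1)) / 2) ⟨by linarith, by linarith⟩ ⟨j n, ?_⟩
  rw [b.height_affine n _ ⟨by linarith, by linarith⟩, hw, b.height_zero]
  ring

theorem Bounces.face_succ (b : Bounces r c l T p side e j w f) (h : FoldedCurve r c l T p side)
    (n : ℕ) : f (n + 1) = !f n := by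
  have := h.side_ne (b.lt_succ h n) (b.lt_succ h (n + 1)) (b.no_edge n) (b.mem_edgeTimes _)
    (b.subset_side n) (b.subset_side (n + 1))
  revert this
  cases f n <;> cases f (n + 1) <;> simp

theorem Bounces.reflection (b : Bounces r c l T p side e j w f) (h : FoldedCurve r c l T p side)
    (n : ℕ) {i m k : Fin 3} (him : i ≠ m) (hik : i ≠ k) (hmk : m ≠ k) (hm : j (n + 1) = m) :
    slope3 i (w (n + 1)) = -slope3 k (w n) ∧ slope3 m (w (n + 1)) = -slope3 m (w n) ∧
      slope3 k (w (n + 1)) = -slope3 i (w n) :=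
  h.reflection_law (b.gap n) (b.gap (n + 1)) (b.norm_eq n) (b.norm_eq (n + 1)) (b.affine n)
    (b.affine (n + 1)) him hik hmk (hm ▸ b.height_zero (n + 1))

theorem Bounces.slope_ne (b : Bounces r c l T p side e j w f) (h : FoldedCurve r c l T p side)
    (n : ℕ) {i m k : Fin 3} (him : i ≠ m) (hik : i ≠ k) (hmk : m ≠ k)
    (h1 : slope3 i (w n) = slope3 m (w n)) (h2 : slope3 i (w n) = slope3 k (w n)) : False := by
  have s := sum_slope3 (w n)
  have q := norm_sq_eq_slope3 (w n)
  have hc := h.c_pos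
  rw [sum_fin_three him hik hmk] at s q
  rw [b.norm_eq, ← h1, ← h2, show slope3 i (w n) = 0 by linarith] at q
  nlinarith

/-- Five gaps of at least `l` already fill the period `5 * l`, and `e 0 + T` is itself an edge time.
-/
theorem Bounces.exists_period (b : Bounces r c l T p side e j w f)
    (h : FoldedCurve r c l T p side) (hT : T = 5 * l) :
    ∃ m, 1 ≤ m ∧ m ≤ 5 ∧ e m = e 0 + T := by
  have hl := h.l_pos
  have h5 : e 0 + T ≤ e 5 := by
    linarith [b.gap 0, b.gap 1, b.gap 2, b.gap 3, b.gap 4]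
  classical
  have hex : ∃ n, e 0 + T ≤ e n := ⟨5, h5⟩
  have hs := Nat.find_spec hex
  have hm5 := Nat.find_min' hex h5
  have hpos : Nat.find hex ≠ 0 := by
    intro h0
    rw [h0] at hs
    linarith
  obtain ⟨n, hn⟩ := Nat.exists_eq_succ_of_ne_zero hpos
  have hlt := Nat.find_min hex (m := n) (by omega)
  rw [hn] at hs
  refine ⟨n + 1, by omega, by omega, le_antisymm ?_ hs⟩
  exact b.succ_le ((h.edgeTimes_add _).2 (b.mem_edgeTimes 0)) (not_le.1 hlt)

theorem Bounces.periodic (b : Bounces r c l T p side e j w f)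
    (h : FoldedCurve r c l T p side) {m : ℕ} (hm : e m = e 0 + T) (n : ℕ) :
    e (n + m) = e n + T := by
  induction n with
  | zero => simpa using hm
  | succ n ih =>
    rw [show n + 1 + m = n + m + 1 by ring]
    apply le_antisymm
    · refine b.succ_le ((h.edgeTimes_add _).2 (b.mem_edgeTimes _)) ?_
      rw [ih]; linarith [b.lt_succ h n]
    · have := b.succ_le (n := n) (x := e (n + m + 1) - T)
        ((h.edgeTimes_add _).1 (by simpa using b.mem_edgeTimes _))
        (by linarith [b.lt_succ h (n + m)])
      linarith

theorem Bounces.side_periodic (b : Bounces r c l T p side e j w f)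
    (h : FoldedCurve r c l T p side) {m : ℕ} (hm : ∀ n, e (n + m) = e n + T) (n : ℕ) :
    j (n + m) = j n := by
  apply h.eq_of_height_eq_zero (e := e n) _ (b.height_zero n)
  rw [← h.periodic, ← hm]
  exact b.height_zero _

theorem Bounces.velocity_periodic (b : Bounces r c l T p side e j w f)
    (h : FoldedCurve r c l T p side) {m : ℕ} (hm : ∀ n, e (n + m) = e n + T) (n : ℕ) :
    w (n + m) = w n := by
  have lt := b.lt_succ h n
  have h1 := b.affine n (e (n + 1)) ⟨lt.le, le_rfl⟩
  have h2 := b.affine (n + m) (e (n + m + 1)) ⟨(b.lt_succ h _).le, le_rfl⟩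
  rw [show n + m + 1 = n + 1 + m by ring, hm, hm, h.periodic, h.periodic, h1,
    add_sub_add_right_eq_sub] at h2
  exact (smul_right_injective ℂ (by linarith : e (n + 1) - e n ≠ 0) (add_left_cancel h2)).symm

/-- If the faces differed, periodicity would put an interior point of the arc on both faces, hence
on an edge. -/
theorem Bounces.face_periodic (b : Bounces r c l T p side e j w f)
    (h : FoldedCurve r c l T p side) {m : ℕ} (hm : ∀ n, e (n + m) = e n + T) (n : ℕ) :
    f (n + m) = f n := by
  by_contra hne
  have lt := b.lt_succ h n
  refine b.no_edge n ((e n + e (n + 1)) / 2) ⟨by linarith, by linarith⟩ ((h.edge_iff _).1 ?_)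
  have h1 : (e n + e (n + 1)) / 2 ∈ side (f n) := b.subset_side n ⟨by linarith, by linarith⟩
  have h2 : (e n + e (n + 1)) / 2 ∈ side (f (n + m)) := by
    rw [← h.side_periodic]
    refine b.subset_side (n + m) ⟨?_, ?_⟩
    · rw [hm]; linarith
    · rw [show n + m + 1 = n + 1 + m by ring, hm]; linarith
  intro i
  revert h1 h2 hne
  cases f n <;> cases f (n + m) <;> cases i <;> simp +contextual

/-- The two reflections compose to a rotation that permutes the three slopes cyclically. A fixed
velocity has equal slopes with sum zero. -/
theorem Bounces.not_period_two (b : Bounces r c l T p side e j w f)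
    (h : FoldedCurve r c l T p side) (hm : ∀ n, e (n + 2) = e n + T) : False := by
  have h01 := b.side_succ_ne h 0
  have j2 : j (1 + 1) = j 0 := b.side_periodic h hm 0
  have w2 : w (1 + 1) = w 0 := b.velocity_periodic h hm 0
  obtain ⟨k, h0k, h1k⟩ : ∃ k, j 0 ≠ k ∧ j (0 + 1) ≠ k := by
    generalize j 0 = x at *
    generalize j (0 + 1) = y at *
    clear * -
    decide +revert
  obtain ⟨a1, a2, a3⟩ := b.reflection h 0 h01 h0k h1k rfl
  obtain ⟨b1, b2, b3⟩ := b.reflection h 1 h01.symm h1k h0k j2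
  rw [w2] at b1 b2 b3
  simp only [zero_add] at *
  exact b.slope_ne h 0 h0k h01 h1k.symm (by linarith) (by linarith)

theorem Bounces.not_period_four_of_eq (b : Bounces r c l T p side e j w f)
    (h : FoldedCurve r c l T p side) (hT : T = 5 * l) (hm : ∀ n, e (n + 4) = e n + T)
    (h02 : j 2 = j 0) : False := by
  have hl := h.l_pos
  have hc := h.c_pos
  have hab := b.side_succ_ne h 0
  have had := b.side_succ_ne h 3
  have j4 : j (3 + 1) = j 0 := b.side_periodic h hm 0
  have w4 : w (3 + 1) = w 0 := b.velocity_periodic h hm 0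
  have e4 : e (3 + 1) = e 0 + T := hm 0
  rw [j4] at had
  obtain ⟨a, ha⟩ : ∃ a, a = j 0 := ⟨_, rfl⟩
  obtain ⟨m, hmm⟩ : ∃ m, m = j (0 + 1) := ⟨_, rfl⟩
  rw [← ha, ← hmm] at hab
  rw [← ha] at had j4 h02
  obtain ⟨k, hak, hmk⟩ : ∃ k, a ≠ k ∧ m ≠ k := by clear * -; decide +revert
  obtain ⟨a1, a2, a3⟩ := b.reflection h 0 hab hak hmk hmm.symm
  obtain ⟨b1, b2, b3⟩ := b.reflection h 1 hab.symm hmk hak h02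
  have hcase : j 3 = m ∨ j 3 = k := by
    generalize j 3 = x at *
    clear * - hab hak hmk had
    decide +revert
  simp only [zero_add, Nat.reduceAdd] at *
  rcases hcase with h3 | h3
  -- Sides `a m a m`: the four reflections compose to the square of a rotation of order three, again
  -- without nonzero fixed vector.
  · obtain ⟨c1, c2, c3⟩ := b.reflection h 2 hab hak hmk h3
    obtain ⟨d1, d2, d3⟩ := b.reflection h 3 hab.symm hmk hak j4
    simp only [Nat.reduceAdd] at *
    rw [w4] at d1 d2 d3
    exact b.slope_ne h 0 hab hak hmk (by linarith) (by linarith)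
  -- Sides `a m a k`: the four reflections compose to the identity, so directions give no
  -- contradiction and positions have to be used.
  · obtain ⟨c1, c2, c3⟩ := b.reflection h 2 hak hab hmk.symm h3
    simp only [Nat.reduceAdd] at *
    have p1 : 0 < height r a (p (e 1)) := lt_of_le_of_ne (h.face _ _)
      fun h0 => hab (by rw [hmm]; exact h.eq_of_height_eq_zero h0.symm (b.height_zero 1))
    have p3 : 0 < height r a (p (e 3)) := lt_of_le_of_ne (h.face _ _)
      fun h0 => had.symm (h.eq_of_height_eq_zero h0.symm (b.height_zero 3))
    have z0 : height r a (p (e 0)) = 0 := ha ▸ b.height_zero 0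
    have z1 : height r m (p (e 1)) = 0 := hmm ▸ b.height_zero 1
    have z2 : height r a (p (e 2)) = 0 := h02 ▸ b.height_zero 2
    have z3 : height r k (p (e 3)) = 0 := h3 ▸ b.height_zero 3
    have pe4 : p (e 4) = p (e 0) := by rw [e4, h.periodic]
    have A0 := b.height_succ h 0 a
    have A1 := b.height_succ h 1 a
    have A2 := b.height_succ h 2 a
    have A3 := b.height_succ h 3 a
    have M0 := b.height_succ h 0 m
    have M1 := b.height_succ h 1 m
    have M2 := b.height_succ h 2 m
    have M3 := b.height_succ h 3 m
    have s0 := sum_slope3 (w 0)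
    have n0 := norm_sq_eq_slope3 (w 0)
    rw [sum_fin_three hab hak hmk] at s0 n0
    rw [b.norm_eq] at n0
    have g0 := b.gap 0
    have g1 := b.gap 1
    have g2 := b.gap 2
    have g3 := b.gap 3
    simp only [zero_add, Nat.reduceAdd] at *
    rw [pe4] at A3 M3
    rw [b1, a3] at M2
    rw [b2, a1] at A2
    rw [c1, b1, a3] at A3
    rw [c3, b2, a1] at M3
    rw [a1] at A1
    rw [a2] at M1
    rw [z0] at A0 A3
    rw [z2] at A1 A2
    rw [z1] at M0 M1
    obtain ⟨α, hα⟩ : ∃ α, α = slope3 a (w 0) := ⟨_, rfl⟩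
    obtain ⟨γ, hγ⟩ : ∃ γ, γ = slope3 k (w 0) := ⟨_, rfl⟩
    have hβ : slope3 m (w 0) = -(α + γ) := by linarith
    rw [← hα] at a3 A0 M2 A3 n0
    rw [← hγ] at a1 A1 A2 M3 n0
    rw [hβ] at a2 M0 M1 n0
    obtain ⟨x0, hx0⟩ : ∃ x, x = e 1 - e 0 := ⟨_, rfl⟩
    obtain ⟨x1, hx1⟩ : ∃ x, x = e 2 - e 1 := ⟨_, rfl⟩
    obtain ⟨x2, hx2⟩ : ∃ x, x = e 3 - e 2 := ⟨_, rfl⟩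
    obtain ⟨x3, hx3⟩ : ∃ x, x = e 4 - e 3 := ⟨_, rfl⟩
    rw [← hx0] at A0 M0
    rw [← hx1] at A1 M1
    rw [← hx2] at A2 M2
    rw [← hx3] at A3 M3
    have x0p : 0 < x0 := by linarith
    have x1p : 0 < x1 := by linarith
    have x2p : 0 < x2 := by linarith
    have x3p : 0 < x3 := by linarith
    have αp : 0 < α := (mul_pos_iff_of_pos_left x0p).1 (by linarith)
    have γp : 0 < γ := (mul_pos_iff_of_pos_left x2p).1 (by linarith)
    -- The first two balances say that the height over `a` returns to zero on each excursion from
    -- `a`, via `m` and via `k`. The third says that the height over `m` closes up after a period.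
    have E1 : x0 * α = x1 * γ := by linarith
    have E2 : x2 * γ = x3 * α := by linarith
    have E3 : (α + γ) * (x1 - x0) = x3 * γ - x2 * α := by linarith
    have hαγ : α = γ := eq_of_balance αp γp x0p x2p E1 E2 E3
    subst hαγ
    have hc2 : α = c / 2 := by
      have : c ^ 2 = (2 * α) ^ 2 := by rw [n0]; ring
      have := (sq_eq_sq₀ hc.le (by positivity)).1 this
      linarith
    have f1 : x0 = x1 := mul_right_cancel₀ αp.ne' E1
    have f2 : x2 = x3 := mul_right_cancel₀ αp.ne' E2
    -- Now `α = γ = c / 2`, so `m` and `k` are crossed perpendicularly. The arcs before these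
    -- crossings last at least `3 l / 2`, and by `f1`, `f2` so do the arcs after them: in all at
    -- least `6 l`, against `T = 5 l`.
    have L1 := h.long_arc g0 g1 (b.affine 0) (b.affine 1) hab hak hmk z0 z1 (by linarith)
      (by linarith) (by linarith) (by linarith) (by linarith) (by linarith)
    have L2 := h.long_arc g2 g3 (b.affine 2) (b.affine 3) hak hab hmk.symm z2 z3 (by linarith)
      (by linarith) (by linarith) (by linarith) (by linarith) (by linarith)
    linarith

theorem Bounces.not_period_four (b : Bounces r c l T p side e j w f)
    (h : FoldedCurve r c l T p side) (hT : T = 5 * l) (hm : ∀ n, e (n + 4) = e n + T) :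
    False := by
  have h0 := b.side_succ_ne h 0
  have h1 := b.side_succ_ne h 1
  have h2 := b.side_succ_ne h 2
  have h3 := b.side_succ_ne h 3
  have h4 : j 4 = j 0 := b.side_periodic h hm 0
  -- Otherwise `{j 0, j 2}` and `{j 1, j 3}` would be disjoint pairs among three sides.
  have : j 2 = j 0 ∨ j 3 = j 1 := by
    simp only [zero_add, Nat.reduceAdd, h4] at *
    generalize j 0 = x at *
    generalize j 1 = y at *
    generalize j 2 = z at *
    generalize j 3 = u at *
    clear * - h0 h1 h2 h3
    decide +revert
  rcases this with h' | h'
  · exact b.not_period_four_of_eq h hT hm h'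
  · exact b.shift.not_period_four_of_eq h hT (fun n => hm (n + 1)) h'

/-- Faces alternate and repeat with the bouncing period, so odd periods are excluded by parity. -/
theorem not_five (h : FoldedCurve r c l T p side) (hT : T = 5 * l) : False := by
  obtain ⟨e, j, w, f, b⟩ := h.exists_bounces
  obtain ⟨m, h1, h5, hm⟩ := b.exists_period h hT
  have hper := b.periodic h hm
  have hf := b.face_periodic h hper 0
  have hs := b.face_succ h
  have f1 := hs 0
  have f2 := hs 1
  have f3 := hs 2
  have f4 := hs 3
  have f5 := hs 4
  interval_cases m
  · simp_all
  · exact b.not_period_two h hper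
  · simp_all
  · exact b.not_period_four h hT hper
  · simp_all

end FoldedCurve

/-! ### Points and distances in the doubled triangle -/

/-- The inclusions of the two faces. -/
def faceMap (r : ℝ) (i : Bool) : polygonFace 3 r → DoubledPolygon 3 r :=
  if i then topFace 3 r else bottomFace 3 r

theorem dist_faceMap (r : ℝ) (i : Bool) (x y : polygonFace 3 r) :
    dist (faceMap r i x) (faceMap r i y) = dist (x : ℂ) y := by
  cases i
  · exact dist_bottomFace 3 r x y
  · exact dist_topFace 3 r x y

theorem dist_faceMap_ne (r : ℝ) {i i' : Bool} (hi : i ≠ i') (x y : polygonFace 3 r) :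
    dist (faceMap r i x) (faceMap r i' y) =
      ⨅ z : polygonEdges 3 r, (dist (x : ℂ) (z : ℂ) + dist (z : ℂ) (y : ℂ)) := by
  cases i <;> cases i' <;> try exact absurd rfl hi
  · refine (dist_comm _ _).trans ((dist_topFace_bottomFace 3 r y x).trans ?_)
    refine iInf_congr fun z => ?_
    rw [dist_comm (y : ℂ), dist_comm _ (x : ℂ), add_comm]
  · exact dist_topFace_bottomFace 3 r x y

theorem exists_faceMap (r : ℝ) (q : DoubledPolygon 3 r) : ∃ i x, faceMap r i x = q := by
  induction q using Quotient.inductionOn with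
  | h q =>
    rcases q with x | x
    · exact ⟨true, x, rfl⟩
    · exact ⟨false, x, rfl⟩

theorem bddBelow_dist_add_dist (r : ℝ) (x y : ℂ) :
    BddBelow (Set.range fun z : polygonEdges 3 r => dist x (z : ℂ) + dist (z : ℂ) y) :=
  ⟨0, by rintro _ ⟨z, rfl⟩; positivity⟩

theorem dist_faceMap_le (r : ℝ) (i i' : Bool) (x y : polygonFace 3 r) (z : ℂ)
    (hz : z ∈ polygonEdges 3 r) :
    dist (faceMap r i x) (faceMap r i' y) ≤ dist (x : ℂ) z + dist z (y : ℂ) := by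
  by_cases hi : i = i'
  · subst hi
    rw [dist_faceMap]
    exact dist_triangle _ _ _
  · rw [dist_faceMap_ne r hi]
    exact ciInf_le (bddBelow_dist_add_dist r x y) ⟨z, hz⟩

/-- Folding the double onto one triangle does not increase distances. Hence the projection of a
point does not depend on the face chosen to represent it. -/
theorem dist_le_dist_faceMap (r : ℝ) (i i' : Bool) (x y : polygonFace 3 r) :
    dist (x : ℂ) y ≤ dist (faceMap r i x) (faceMap r i' y) := by
  by_cases hi : i = i'
  · subst hi
    rw [dist_faceMap]
  · rw [dist_faceMap_ne r hi]
    exact le_ciInf fun z => dist_triangle _ _ _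

theorem coe_eq_of_faceMap_eq {r : ℝ} {i i' : Bool} {x y : polygonFace 3 r}
    (h : faceMap r i x = faceMap r i' y) : (x : ℂ) = y := by
  have := dist_le_dist_faceMap r i i' x y
  rw [h, dist_self] at this
  exact dist_le_zero.1 this

theorem faceMap_eq_of_height {r : ℝ} (hr : 0 < r) (i i' : Bool) (x : polygonFace 3 r) {j : Fin 3}
    (hj : height r j x = 0) : faceMap r i x = faceMap r i' x := by
  have := dist_faceMap_le r i i' x x x
    ((mem_polygonEdges_three hr _).2 ⟨(mem_polygonFace_three hr _).1 x.2, j, hj⟩)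
  rw [dist_self, add_zero] at this
  exact dist_le_zero.1 this

theorem exists_height_of_faceMap_eq {r : ℝ} (hr : 0 < r) {i i' : Bool} (hi : i ≠ i')
    {x y : polygonFace 3 r} (h : faceMap r i x = faceMap r i' y) : ∃ j, height r j x = 0 := by
  have hxy := coe_eq_of_faceMap_eq h
  by_contra! hne
  have hpos : ∀ j, 0 < height r j x := fun j =>
    lt_of_le_of_ne ((mem_polygonFace_three hr _).1 x.2 j) (hne j).symm
  -- The least height bounds from below the distance to every edge point, hence to everything on the
  -- other face.
  obtain ⟨d, hd, h0⟩ : ∃ d, 0 < d ∧ ∀ j, d ≤ height r j x := by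
    refine ⟨min (height r 0 x) (min (height r 1 x) (height r 2 x)),
      lt_min (hpos 0) (lt_min (hpos 1) (hpos 2)), fun j => ?_⟩
    fin_cases j <;> simp
  have h1 : d ≤ dist (faceMap r i x) (faceMap r i' y) := by
    rw [dist_faceMap_ne r hi]
    refine le_ciInf fun z => ?_
    obtain ⟨-, j, hj⟩ := (mem_polygonEdges_three hr _).1 z.2
    have h2 := (le_abs_self _).trans (abs_height_sub_le r j x z)
    rw [hj] at h2
    have := h0 j
    have : 0 ≤ dist (z : ℂ) y := dist_nonneg
    linarith
  rw [h, dist_self] at h1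
  linarith

theorem isClosed_polygonFace_three {r : ℝ} (hr : 0 < r) : IsClosed (polygonFace 3 r) := by
  have : polygonFace 3 r = ⋂ j, {z | 0 ≤ height r j z} := by
    ext z
    simp [mem_polygonFace_three hr]
  rw [this]
  exact isClosed_iInter fun j => isClosed_le continuous_const (continuous_height r j)

theorem isClosed_range_faceMap {r : ℝ} (hr : 0 < r) (i : Bool) :
    IsClosed (Set.range (faceMap r i)) := by
  have hiso : Isometry (faceMap r i) := Isometry.of_dist_eq fun x y => dist_faceMap r i x y
  have : CompleteSpace (polygonFace 3 r) := (isClosed_polygonFace_three hr).completeSpace_coe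
  exact hiso.isClosedEmbedding.isClosed_range

/-- A periodic curve in the doubled triangle that multiplies small distances by a constant. -/
theorem exists_foldedCurve {r c l T : ℝ} (hr : 0 < r) (hc : 0 < c) (hl : 0 < l) (hlT : l ≤ T)
    (f : ℝ → DoubledPolygon 3 r) (hf : ∀ t, f (t + T) = f t)
    (hd : ∀ s t, s ≤ t → t - s ≤ l → dist (f s) (f t) = c * (t - s)) :
    ∃ p side, FoldedCurve r c l T p side := by
  choose i x hx using fun t => exists_faceMap r (f t)
  have hcont : Continuous f := by
    rw [Metric.continuous_iff]
    intro t ε hε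
    refine ⟨min l (ε / c), lt_min hl (by positivity), fun s hs => ?_⟩
    have h1 := hs.trans_le (min_le_left _ _)
    have h2 := hs.trans_le (min_le_right _ _)
    rw [lt_div_iff₀ hc, Real.dist_eq] at h2
    rw [Real.dist_eq] at h1
    rcases le_total s t with hst | hst
    · rw [abs_of_nonpos (by linarith)] at h1 h2
      rw [hd s t hst (by linarith)]
      linarith
    · rw [abs_of_nonneg (by linarith)] at h1 h2
      rw [dist_comm, hd t s hst (by linarith)]
      linarith
  have hside : ∀ {k t}, t ∈ f ⁻¹' Set.range (faceMap r k) → faceMap r k (x t) = f t := by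
    rintro k t ⟨y, hy⟩
    rw [← hy]
    congr 1
    exact Subtype.ext (coe_eq_of_faceMap_eq ((hx t).trans hy.symm))
  refine ⟨fun t => x t, fun k => f ⁻¹' Set.range (faceMap r k),
    { r_pos := hr
      c_pos := hc
      l_pos := hl
      l_le := hlT
      face := fun t => (mem_polygonFace_three hr _).1 (x t).2
      cover := fun t => ⟨i t, x t, hx t⟩
      closed := fun k => (isClosed_range_faceMap hr k).preimage hcont
      edge_iff := fun t => ⟨fun h => ?_, fun ⟨j, hj⟩ k => ?_⟩
      dist_same := fun k s hs t ht hst htl => ?_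
      le_edge := fun s t hst htl z hz hz' => ?_
      periodic := fun t => ?_
      side_periodic := fun k t => ?_ }⟩
  · exact exists_height_of_faceMap_eq hr (i := true) (i' := false) (by simp)
      ((hside (h true)).trans (hside (h false)).symm)
  · exact ⟨x t, (faceMap_eq_of_height hr k (i t) (x t) hj).trans (hx t)⟩
  · rw [← hd s t hst htl, ← dist_faceMap r k, hside hs, hside ht]
  · rw [← hd s t hst htl, ← hx s, ← hx t]
    exact dist_faceMap_le r _ _ _ _ z ((mem_polygonEdges_three hr z).2 ⟨hz, hz'⟩)
  · exact coe_eq_of_faceMap_eq ((hx (t + T)).trans ((hf t).trans (hx t).symm))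
  · simp only [Set.mem_preimage, hf]

/-! ### Constant speed and local distances -/

theorem periodicLift_add {M : Type*} [MetricSpace M] (γ : ParamCircle → M) (t : ℝ) :
    periodicLift γ (t + 2 * Real.pi) = periodicLift γ t := by
  simp only [periodicLift]
  congr 1
  exact AddCircle.coe_add_period _ t

theorem eVariationOn_Icc_of_speed {M : Type*} [MetricSpace M] {f : ℝ → M} {c : ℝ≥0}
    (h : HasConstantSpeedOnWith f Set.univ c) (a b : ℝ) :
    eVariationOn f (Set.Icc a b) = ENNReal.ofReal (c * (b - a)) := by
  simpa using h (Set.mem_univ a) (Set.mem_univ b)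

theorem dist_le_of_speed {M : Type*} [MetricSpace M] {f : ℝ → M} {c : ℝ≥0}
    (h : HasConstantSpeedOnWith f Set.univ c) {a b : ℝ} (hab : a ≤ b) :
    dist (f a) (f b) ≤ c * (b - a) := by
  have h1 := eVariationOn.edist_le f (s := Set.Icc a b) (x := a) (y := b) ⟨le_rfl, hab⟩
    ⟨hab, le_rfl⟩
  rw [eVariationOn_Icc_of_speed h, edist_dist] at h1
  exact (ENNReal.ofReal_le_ofReal_iff (mul_nonneg c.2 (by linarith))).1 h1

theorem IsOneOverGeodesic.exists_dist_eq {M : Type*} [MetricSpace M] {k : ℕ} {γ : ParamCircle → M}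
    (h : IsOneOverGeodesic k γ) : ∃ c : ℝ, 0 < c ∧ ∀ s t, s ≤ t → t - s ≤ 2 * Real.pi / k →
      dist (periodicLift γ s) (periodicLift γ t) = c * (t - s) := by
  obtain ⟨c, hc, hs⟩ := h.closed_geodesic.constant_speed
  have hk : (0 : ℝ) < k := by exact_mod_cast h.pos
  refine ⟨c, hc, fun s t hst htl => le_antisymm (dist_le_of_speed hs hst) ?_⟩
  have hpos : 0 < 2 * Real.pi / k := by positivity
  have hm := h.minimizes s (s + 2 * Real.pi / k) (by linarith) (by
    rw [closedLength, eVariationOn_Icc_of_speed hs, eVariationOn_Icc_of_speed hs,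
      ← ENNReal.ofReal_natCast, ← ENNReal.ofReal_div_of_pos hk]
    congr 1
    ring)
  rw [MinimizesOn, eVariationOn_Icc_of_speed hs, edist_dist] at hm
  replace hm := (ENNReal.ofReal_eq_ofReal_iff
    (mul_nonneg c.coe_nonneg (by linarith)) dist_nonneg).1 hm
  -- The remainder of the interval is no longer than the speed allows, so a shortfall on `[s, t]`
  -- would contradict minimality on the full interval.
  have h1 := dist_le_of_speed hs (a := t) (b := s + 2 * Real.pi / k) (by linarith)
  have h2 := dist_triangle (periodicLift γ s) (periodicLift γ t)
    (periodicLift γ (s + 2 * Real.pi / k))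
  linarith

theorem six_le_of_mem_geodesicIndices {r : ℝ} (hr : 0 < r) {k : ℕ}
    (hk : k ∈ geodesicIndices (DoubledPolygon 3 r)) : 6 ≤ k := by
  obtain ⟨γ, hγ⟩ := hk
  by_contra! hlt
  have hk0 : (0 : ℝ) < k := by exact_mod_cast hγ.pos
  have hk5 : (k : ℝ) ≤ 5 := by exact_mod_cast Nat.lt_succ_iff.1 hlt
  obtain ⟨c, hc, hd⟩ := hγ.exists_dist_eq
  have hπ := Real.pi_pos
  have hle : 2 * Real.pi / 5 ≤ 2 * Real.pi / k := div_le_div_of_nonneg_left (by positivity) hk0 hk5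
  obtain ⟨p, side, h⟩ := exists_foldedCurve (l := 2 * Real.pi / 5) (T := 2 * Real.pi) hr hc
    (by positivity) (by linarith) (periodicLift γ) (periodicLift_add γ)
    (fun s t hst htl => hd s t hst (htl.trans hle))
  exact h.not_five (by ring)

/-! ### From small distances to constant speed -/

theorem eVariationOn_Icc_of_dist {M : Type*} [MetricSpace M] {f : ℝ → M} {c l : ℝ} (hc : 0 ≤ c)
    (hl : 0 < l) (hd : ∀ s t, s ≤ t → t - s ≤ l → dist (f s) (f t) = c * (t - s)) {a b : ℝ}
    (hab : a ≤ b) : eVariationOn f (Set.Icc a b) = ENNReal.ofReal (c * (b - a)) := by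
  have small : ∀ a b, a ≤ b → b - a ≤ l →
      eVariationOn f (Set.Icc a b) = ENNReal.ofReal (c * (b - a)) := by
    intro a b hab hl
    have hmono : Monotone fun t : ℝ => c * t := fun x y hxy => mul_le_mul_of_nonneg_left hxy hc
    have h1 := (hmono.monotoneOn (Set.Icc a b)).eVariationOn_eq (a := a) (b := b) ⟨le_rfl, hab⟩
      ⟨hab, le_rfl⟩
    rw [Set.inter_self, ← mul_sub] at h1
    rw [← h1]
    -- On a short interval every partition sum agrees with that of the monotone function `t ↦ c *
    -- t`.
    refine iSup_congr fun q => Finset.sum_congr rfl fun i _ => ?_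
    have hq := q.2.2.1 (Nat.le_succ i)
    have ha := (q.2.2.2 i).1
    have hb := (q.2.2.2 (i + 1)).2
    rw [edist_dist, edist_dist, dist_comm, hd _ _ hq (by linarith), Real.dist_eq, ← mul_sub,
      abs_of_nonneg (mul_nonneg hc (sub_nonneg.2 hq))]
  have all : ∀ n : ℕ, ∀ b, a ≤ b → b ≤ a + (n + 1) * l →
      eVariationOn f (Set.Icc a b) = ENNReal.ofReal (c * (b - a)) := by
    intro n
    induction n with
    | zero => exact fun b h1 h2 => small a b h1 (by simp at h2; linarith)
    | succ n ih =>
      intro b h1 h2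
      push_cast at h2
      have hn : 0 ≤ (n : ℝ) * l := by positivity
      rcases le_or_gt b (a + (n + 1) * l) with h3 | h3
      · exact ih b h1 h3
      have h := eVariationOn.Icc_add_Icc f (s := Set.univ) (a := a) (b := a + (n + 1) * l) (c := b)
        (by linarith) h3.le (Set.mem_univ _)
      simp only [Set.univ_inter] at h
      rw [← h, ih _ (by linarith) le_rfl, small _ _ h3.le (by linarith), ← ENNReal.ofReal_add]
      · congr 1; ring
      · exact mul_nonneg hc (by linarith)
      · exact mul_nonneg hc (by linarith)
  obtain ⟨n, hn⟩ := exists_nat_gt ((b - a) / l)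
  rw [div_lt_iff₀ hl] at hn
  exact all n b hab (by linarith)

/-- A `2π`-periodic curve that multiplies distances by `c` on intervals of length at most
`2π / k` defines a `1/k`-geodesic. -/
theorem isOneOverGeodesic_of_dist {M : Type*} [MetricSpace M] {γ : ParamCircle → M} {c : ℝ}
    {k : ℕ} (hc : 0 < c) (hk : 0 < k)
    (hd : ∀ s t, s ≤ t → t - s ≤ 2 * Real.pi / k →
      dist (periodicLift γ s) (periodicLift γ t) = c * (t - s)) : IsOneOverGeodesic k γ := by
  have hk' : (0 : ℝ) < k := by exact_mod_cast hk
  have hπ := Real.pi_pos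
  have hl : 0 < 2 * Real.pi / k := by positivity
  have hv : ∀ a b, a ≤ b → eVariationOn (periodicLift γ) (Set.Icc a b) =
      ENNReal.ofReal (c * (b - a)) := fun a b hab => eVariationOn_Icc_of_dist hc.le hl hd hab
  have hmin : ∀ a b, a ≤ b → b - a ≤ 2 * Real.pi / k → MinimizesOn (periodicLift γ) a b := by
    intro a b hab hbl
    rw [MinimizesOn, hv a b hab, edist_dist, hd a b hab hbl]
  refine ⟨hk, ⟨⟨c.toNNReal, Real.toNNReal_pos.2 hc, ?_⟩, fun t => ⟨Real.pi / k, by positivity, ?_⟩⟩,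
    fun a b hab h => hmin a b hab ?_⟩
  · rw [hasConstantSpeedOnWith_iff_ordered]
    intro a _ b _ hab
    rw [Set.univ_inter, hv a b hab, Real.coe_toNNReal _ hc.le]
  · have : Real.pi / k = 2 * Real.pi / k / 2 := by ring
    exact hmin _ _ (by linarith) (by linarith)
  · rw [closedLength, hv _ _ hab, hv _ _ (by positivity), ← ENNReal.ofReal_natCast,
      ← ENNReal.ofReal_div_of_pos hk', ENNReal.ofReal_eq_ofReal_iff
      (mul_nonneg hc.le (by linarith)) (by rw [sub_zero]; positivity)] at h
    have : c * (b - a) = c * (2 * Real.pi / k) := by rw [h]; ring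
    exact (mul_left_cancel₀ hc.ne' this).le

/-! ### The doubled Fagnano billiard orbit -/

/-- The side of the triangle met at the integral parameter `n`. -/
def fagnanoSide (n : ℤ) : Fin 3 := (n : ZMod 3)

theorem fagnanoSide_succ (n : ℤ) : fagnanoSide (n + 1) = fagnanoSide n + 1 := by
  change ((n + 1 : ℤ) : ZMod 3) = (n : ZMod 3) + 1
  push_cast
  rfl

theorem fagnanoSide_add_six (n : ℤ) : fagnanoSide (n + 6) = fagnanoSide n := by
  change ((n + 6 : ℤ) : ZMod 3) = (n : ZMod 3)
  push_cast
  have : (6 : ZMod 3) = 0 := by decide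
  rw [this, add_zero]

/-- The heights along the arc of the orbit that starts at the middle of the side `a`. -/
def fagnanoHeight (r : ℝ) (a : Fin 3) (x : ℝ) (i : Fin 3) : ℝ :=
  if i = a then 3 * r / 4 * x else if i = a + 1 then 3 * r / 4 * (1 - x) else 3 * r / 4

theorem fin_three_distinct (a : Fin 3) : a ≠ a + 1 ∧ a ≠ a + 2 ∧ a + 1 ≠ a + 2 := by
  decide +revert

theorem fagnanoHeight_self (r : ℝ) (a : Fin 3) (x : ℝ) :
    fagnanoHeight r a x a = 3 * r / 4 * x := by simp [fagnanoHeight]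

theorem fagnanoHeight_one (r : ℝ) (a : Fin 3) (x : ℝ) :
    fagnanoHeight r a x (a + 1) = 3 * r / 4 * (1 - x) := by
  simp [fagnanoHeight]

theorem fagnanoHeight_two (r : ℝ) (a : Fin 3) (x : ℝ) :
    fagnanoHeight r a x (a + 2) = 3 * r / 4 := by
  obtain ⟨-, h2, h3⟩ := fin_three_distinct a
  rw [fagnanoHeight, if_neg h2.symm, if_neg h3.symm]

theorem sum_fagnanoHeight (r : ℝ) (a : Fin 3) (x : ℝ) :
    ∑ i, fagnanoHeight r a x i = 3 * r / 2 := by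
  obtain ⟨h1, h2, h3⟩ := fin_three_distinct a
  rw [sum_fin_three h1 h2 h3, fagnanoHeight_self, fagnanoHeight_one, fagnanoHeight_two]
  ring

/-- The projection of the orbit. -/
def fagnanoPoint (r : ℝ) (t : ℝ) : ℂ :=
  ofHeights (fagnanoHeight r (fagnanoSide ⌊t⌋) (Int.fract t))

theorem height_fagnanoPoint (r : ℝ) (t : ℝ) (i : Fin 3) :
    height r i (fagnanoPoint r t) = fagnanoHeight r (fagnanoSide ⌊t⌋) (Int.fract t) i :=
  height_ofHeights r _ (sum_fagnanoHeight r _ _) i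

theorem fagnanoPoint_mem {r : ℝ} (hr : 0 < r) (t : ℝ) : fagnanoPoint r t ∈ polygonFace 3 r := by
  rw [mem_polygonFace_three hr]
  intro i
  rw [height_fagnanoPoint, fagnanoHeight]
  have h0 := Int.fract_nonneg t
  have h1 : 0 ≤ 1 - Int.fract t := by linarith [Int.fract_lt_one t]
  split_ifs <;> positivity

/-- The orbit in the doubled triangle, with period `6`. -/
def fagnanoCurve {r : ℝ} (hr : 0 < r) (t : ℝ) : DoubledPolygon 3 r :=
  faceMap r (decide (Even ⌊t⌋)) ⟨fagnanoPoint r t, fagnanoPoint_mem hr t⟩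

theorem fagnanoCurve_add_six {r : ℝ} (hr : 0 < r) (t : ℝ) :
    fagnanoCurve hr (t + 6) = fagnanoCurve hr t := by
  have h1 : ⌊t + 6⌋ = ⌊t⌋ + 6 := by exact_mod_cast Int.floor_add_intCast t 6
  have h2 : Int.fract (t + 6) = Int.fract t := by exact_mod_cast Int.fract_add_intCast t 6
  have h3 : Even (⌊t⌋ + 6) ↔ Even ⌊t⌋ := by
    rw [Int.even_add]; simp [show Even (6 : ℤ) by decide]
  simp only [fagnanoCurve, fagnanoPoint, h1, h2, h3, fagnanoSide_add_six]

/-- The left side is the squared distance from `x` to the mirror image `y'` of `y` in the side `m`.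
Points of that side are equidistant from `y` and `y'`. -/
theorem reflection_le_dist_add_dist {r : ℝ} {i m k : Fin 3} (him : i ≠ m) (hik : i ≠ k)
    (hmk : m ≠ k) {x y z : ℂ} (hz : height r m z = 0) :
    2 / 3 * ((height r m x + height r m y) ^ 2 +
      (height r i x - height r i y - height r m y) ^ 2 +
      (height r k x - height r k y - height r m y) ^ 2) ≤ (dist x z + dist z y) ^ 2 := by
  have sum := sum_fin_three him hik hmk
  have hy := sum_height r y
  rw [sum] at hy
  obtain ⟨y', yi, ym, yk⟩ := exists_heights (r := r) him hik hmk
    (x := height r i y + height r m y) (y := -height r m y) (z := height r k y + height r m y)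
    (by linarith)
  have h1 : dist z y = dist z y' := by
    rw [← sq_eq_sq₀ dist_nonneg dist_nonneg, dist_sq_eq_height r z y, dist_sq_eq_height r z y',
      sum, sum, yi, ym, yk, hz]
    have hs := sum_height r z
    rw [sum, hz] at hs
    linear_combination (4 / 3) * height r m y * (hs - hy)
  rw [h1]
  calc _ = dist x y' ^ 2 := by
        rw [dist_sq_eq_height r x y', sum, yi, ym, yk]; ring
    _ ≤ _ := pow_le_pow_left₀ dist_nonneg (dist_triangle _ _ _) 2

/-- The path through the midpoint of the side `a + 1` unfolds to a straight segment. Only paths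
through the other two sides need an inequality, where `x + y ≤ 1` enters. -/
theorem dist_across_midpoint {r : ℝ} (hr : 0 < r) (a : Fin 3) {i i' : Bool} (hi : i ≠ i')
    {x y : ℝ} (hx : 0 ≤ x) (hy : 0 ≤ y) (hxy : x + y ≤ 1) (X Y : polygonFace 3 r)
    (hX : ∀ n, height r n X = fagnanoHeight r a (1 - x) n)
    (hY : ∀ n, height r n Y = fagnanoHeight r (a + 1) y n) :
    dist (faceMap r i X) (faceMap r i' Y) = √3 / 2 * r * (x + y) := by
  obtain ⟨h1, h2, h3⟩ := fin_three_distinct a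
  have e1 : a + 1 + 1 = a + 2 := by clear * -; decide +revert
  have e2 : a + 1 + 2 = a := by clear * -; decide +revert
  have X0 := (hX a).trans (fagnanoHeight_self _ _ _)
  have X1 := (hX (a + 1)).trans (fagnanoHeight_one _ _ _)
  have X2 := (hX (a + 2)).trans (fagnanoHeight_two _ _ _)
  have Y1 := (hY (a + 1)).trans (fagnanoHeight_self _ _ _)
  have Y2 := (hY (a + 1 + 1)).trans (fagnanoHeight_one _ _ _)
  have Y0 := (hY (a + 1 + 2)).trans (fagnanoHeight_two _ _ _)
  rw [e1] at Y2
  rw [e2] at Y0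
  have s3 := sq_sqrt_three
  have p3 : 0 < √3 := by positivity
  have sum := sum_fin_three h1 h2 h3
  apply le_antisymm
  · obtain ⟨z, z0, z1, z2⟩ := exists_heights (r := r) h1 h2 h3 (x := 3 * r / 4) (y := 0)
      (z := 3 * r / 4) (by ring)
    refine (dist_faceMap_le r i i' X Y z ((mem_polygonEdges_three hr z).2
      ⟨forall_fin_three h1 h2 h3 (by rw [z0]; positivity) (by rw [z1]) (by rw [z2]; positivity),
        a + 1, z1⟩)).trans (le_of_eq ?_)
    have d1 : dist (X : ℂ) z = √3 / 2 * r * x := by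
      rw [← sq_eq_sq₀ dist_nonneg (by positivity), dist_sq_eq_height r, sum, X0, X1, X2, z0, z1, z2]
      linear_combination (-r ^ 2 * x ^ 2 / 4) * s3
    have d2 : dist z (Y : ℂ) = √3 / 2 * r * y := by
      rw [← sq_eq_sq₀ dist_nonneg (by positivity), dist_sq_eq_height r, sum, Y0, Y1, Y2, z0, z1, z2]
      linear_combination (-r ^ 2 * y ^ 2 / 4) * s3
    rw [d1, d2]
    ring
  · rw [dist_faceMap_ne r hi]
    refine le_ciInf fun z => ?_
    obtain ⟨-, m, hm⟩ := (mem_polygonEdges_three hr _).1 z.2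
    rw [← pow_le_pow_iff_left₀ (by positivity) (by positivity) two_ne_zero]
    have hsq : (√3 / 2 * r * (x + y)) ^ 2 = 3 / 4 * r ^ 2 * (x + y) ^ 2 := by
      linear_combination (r ^ 2 * (x + y) ^ 2 / 4) * s3
    rw [hsq]
    -- Since `2 - u ≥ 1 + v`, the right side is at least `(1 + v)² + (1 - v)² ≥ 2`, while the left
    -- side is at most `2`.
    have hpoly : ∀ u v : ℝ, 0 ≤ u → 0 ≤ v → u + v ≤ 1 →
        2 * (u + v) ^ 2 ≤ (2 - u) ^ 2 + (1 + v - u) ^ 2 + (1 - v) ^ 2 := by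
      intro u v hu hv huv
      have q1 : (u + v) ^ 2 ≤ 1 := by nlinarith
      have q2 : (1 + v) ^ 2 ≤ (2 - u) ^ 2 := by nlinarith
      nlinarith [sq_nonneg (1 + v - u)]
    have hr2 : 0 ≤ r ^ 2 := by positivity
    have hm' : m = a ∨ m = a + 1 ∨ m = a + 2 := by clear * -; decide +revert
    rcases hm' with rfl | rfl | rfl
    · refine le_trans ?_ (reflection_le_dist_add_dist h1.symm h3 h2 hm)
      rw [X0, X1, X2, Y0, Y1, Y2]
      have := mul_le_mul_of_nonneg_left (hpoly x y hx hy hxy) hr2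
      linarith
    · refine le_trans ?_ (reflection_le_dist_add_dist h1 h2 h3 hm)
      rw [X0, X1, X2, Y0, Y1, Y2]
      linarith
    · refine le_trans ?_ (reflection_le_dist_add_dist h2 h1 h3.symm hm)
      rw [X0, X1, X2, Y0, Y1, Y2]
      -- The side `a + 2` is the mirror case of the side `a`, with `x` and `y` exchanged.
      have := mul_le_mul_of_nonneg_left (hpoly y x hy hx (by linarith)) hr2
      linarith

theorem dist_fagnanoCurve {r : ℝ} (hr : 0 < r) {s t : ℝ} (hst : s ≤ t) (hts : t - s ≤ 1) :
    dist (fagnanoCurve hr s) (fagnanoCurve hr t) = √3 / 2 * r * (t - s) := by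
  have fs := Int.floor_add_fract s
  have ft := Int.floor_add_fract t
  have fs1 := Int.fract_lt_one s
  have ft0 := Int.fract_nonneg t
  have ft1 := Int.fract_lt_one t
  have hle : ⌊s⌋ ≤ ⌊t⌋ := Int.floor_le_floor hst
  have hle' : ⌊t⌋ ≤ ⌊s⌋ + 1 := by
    rw [← Int.floor_add_one]; exact Int.floor_le_floor (by linarith)
  rcases (show ⌊t⌋ = ⌊s⌋ ∨ ⌊t⌋ = ⌊s⌋ + 1 by omega) with h | h
  · rw [fagnanoCurve, fagnanoCurve, h, dist_faceMap, ← sq_eq_sq₀ dist_nonneg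
      (mul_nonneg (by positivity) (by linarith)), dist_sq_eq_height r]
    simp only [height_fagnanoPoint, h]
    obtain ⟨h1, h2, h3⟩ := fin_three_distinct (fagnanoSide ⌊s⌋)
    rw [sum_fin_three h1 h2 h3]
    simp only [fagnanoHeight_self, fagnanoHeight_one, fagnanoHeight_two]
    have : t - s = Int.fract t - Int.fract s := by
      rw [h] at ft; linarith
    rw [this]
    linear_combination (-r ^ 2 * (Int.fract t - Int.fract s) ^ 2 / 4) * sq_sqrt_three
  · have ht : (⌊t⌋ : ℝ) = ⌊s⌋ + 1 := by exact_mod_cast h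
    have : t - s = (1 - Int.fract s) + Int.fract t := by linarith
    rw [this]
    -- The parameters `s` and `t` lie on consecutive arcs, hence on opposite faces, at times `1 -
    -- fract s` before and `fract t` after the common midpoint.
    refine dist_across_midpoint hr (fagnanoSide ⌊s⌋) ?_ (by linarith) ft0 (by linarith) _ _
      (fun n => ?_) (fun n => ?_)
    · rw [h, ne_eq, decide_eq_decide, Int.even_add_one]
      tauto
    · rw [height_fagnanoPoint, sub_sub_cancel]
    · rw [height_fagnanoPoint, h, fagnanoSide_succ]

theorem six_mem_geodesicIndices {r : ℝ} (hr : 0 < r) :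
    6 ∈ geodesicIndices (DoubledPolygon 3 r) := by
  have hπ := Real.pi_pos
  have hper : Function.Periodic (fun t : ℝ => fagnanoCurve hr (3 / Real.pi * t)) (2 * Real.pi) := by
    intro t
    have : 3 / Real.pi * (t + 2 * Real.pi) = 3 / Real.pi * t + 6 := by field_simp; ring
    simp only [this, fagnanoCurve_add_six]
  refine ⟨hper.lift, isOneOverGeodesic_of_dist (c := √3 / 2 * r * (3 / Real.pi)) (by positivity)
    (by norm_num) fun s t hst htl => ?_⟩
  have e : ∀ t, periodicLift hper.lift t = fagnanoCurve hr (3 / Real.pi * t) :=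
    fun t => hper.lift_coe t
  have h1 : 3 / Real.pi * t - 3 / Real.pi * s = 3 / Real.pi * (t - s) := by ring
  rw [e, e, dist_fagnanoCurve hr (by gcongr), h1, mul_assoc _ (3 / Real.pi)]
  rw [h1]
  calc 3 / Real.pi * (t - s) ≤ 3 / Real.pi * (2 * Real.pi / (6 : ℕ)) := by gcongr
    _ = 1 := by push_cast; field_simp; norm_num

end

theorem mainTheorem2 (r : ℝ) (hr : 0 < r) :
    minimizingIndex (DoubledPolygon 3 r) = 6 ∧
      IsLeast (geodesicIndices (DoubledPolygon 3 r)) 6 := by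
  have h : IsLeast (geodesicIndices (DoubledPolygon 3 r)) 6 :=
    ⟨six_mem_geodesicIndices hr, fun _ hk => six_le_of_mem_geodesicIndices hr hk⟩
  exact ⟨h.csInf_eq, h⟩
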